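/- Let $\mathbb T=\mathbb R/2\pi\mathbb Z$, let $f\in L^2(\mathbb T)$ be real-valued and even, and put $\hat f(k)=\frac1{2\pi}\int_0^{2\pi}f(x)e^{-ikx}\,dx$ for $k\in\mathbb Z$ and $$V_N=\sum_{k=-N}^{N}|\hat f(k)|^2k^2,\qquad N=1,2,\dots$$ Suppose that $V_N\to\infty$ as $N\to\infty$ and that $(V_N)$ is slowly varying in the sense of Karamata, i.e. $\lim_{N\to\infty}V_{\lfloor\lambda N\rfloor}/V_N=1$ for every real $\lambda>0$. For each $N$ let $\theta_1,\dots,\theta_N$ be the eigenangles of the Circular Unitary Ensemble, i.e. random points of $\mathbb T$ with joint probability density $$p_N(\theta_1,\dots,\theta_N)=\frac1{Z_N}\prod_{1\le j<k\le N}\bigl|e^{i\theta_j}-e^{i\theta_k}\bigr|^2$$ with respect to $d\theta_1\cdots d\theta_N$, where $Z_N$ is the normalizing constant, and let $$S_N(f)=\sum_{1\le i\ne j\le N}f(\theta_i-\theta_j),$$ the sum being over ordered pairs. Then $S_N(f)$ is integrable for every $N$, and $$\frac{S_N(f)-\mathbb E\,S_N(f)}{\sqrt{2V_N}}\longrightarrow\mathcal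 N(0,1)$$ in distribution as $N\to\infty$. -/

import Mathlib

open MeasureTheory ProbabilityTheory Filter Topology

noncomputable section

namespace PairCUE

/-- The circle `𝕋 = ℝ / 2πℤ`. Its `volume` is Lebesgue measure, of total mass `2π`. -/
abbrev Torus : Type := AddCircle (2 * Real.pi)

instance fact_two_pi_pos : Fact (0 < 2 * Real.pi) := ⟨Real.two_pi_pos⟩

/-- The unnormalised CUE density `∏_{j<k} |e^{iθ_j} - e^{iθ_k}|²`. -/
def cueWeight (N : ℕ) (θ : Fin N → Torus) : ℝ :=
  ∏ j : Fin N, ∏ k ∈ Finset.Ioi j,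
    ‖(AddCircle.toCircle (θ j) : ℂ) - (AddCircle.toCircle (θ k) : ℂ)‖ ^ 2

/-- The partition function `Z_N`: the integral of the weight against `dθ_1 ⋯ dθ_N`. -/
def cueZ (N : ℕ) : ℝ := ∫ θ : Fin N → Torus, cueWeight N θ

/-- The joint law of the `N` eigenangles of the CUE. -/
def cueMeasure (N : ℕ) : Measure (Fin N → Torus) :=
  (volume : Measure (Fin N → Torus)).withDensity
    fun θ => ENNReal.ofReal (cueWeight N θ / cueZ N)

theorem cueWeight_nonneg (N : ℕ) (θ : Fin N → Torus) : 0 ≤ cueWeight N θ :=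
  Finset.prod_nonneg fun _ _ => Finset.prod_nonneg fun _ _ => by positivity

theorem continuous_cueWeight (N : ℕ) : Continuous (cueWeight N) := by
  unfold cueWeight
  refine continuous_finsetProd _ fun j _ => continuous_finsetProd _ fun k _ => ?_
  have h (i : Fin N) : Continuous fun θ : Fin N → Torus => (AddCircle.toCircle (θ i) : ℂ) :=
    continuous_subtype_val.comp (AddCircle.continuous_toCircle.comp (continuous_apply i))
  exact ((h j).sub (h k)).norm.pow 2

theorem integrable_cueWeight (N : ℕ) :
    Integrable (cueWeight N) (volume : Measure (Fin N → Torus)) :=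
  (continuous_cueWeight N).integrable_of_hasCompactSupport (HasCompactSupport.of_compactSpace _)

theorem cueZ_pos (N : ℕ) : 0 < cueZ N := by
  have hI : Infinite (Set.Ico (0 : ℝ) (0 + 2 * Real.pi)) :=
    (Set.Ico_infinite (by simp [Real.pi_pos])).to_subtype
  have hinf : Infinite Torus :=
    (AddCircle.equivIco (2 * Real.pi) 0).infinite_iff.mpr hI
  have hθ : ∃ θ : Fin N → Torus, Function.Injective θ :=
    ⟨fun i => Infinite.natEmbedding Torus i,
      (Infinite.natEmbedding Torus).injective.comp Fin.val_injective⟩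
  obtain ⟨θ, hθ⟩ := hθ
  refine (continuous_cueWeight N).integral_pos_of_hasCompactSupport_nonneg_nonzero
    (HasCompactSupport.of_compactSpace _) (cueWeight_nonneg N) (x := θ) ?_
  refine Finset.prod_ne_zero_iff.mpr fun j _ => Finset.prod_ne_zero_iff.mpr fun k hk => ?_
  refine pow_ne_zero _ (norm_ne_zero_iff.mpr (sub_ne_zero.mpr fun h => ?_))
  have h2 := hθ (AddCircle.injective_toCircle Real.two_pi_pos.ne' (Subtype.ext h))
  exact (Finset.mem_Ioi.mp hk).ne h2

instance isProbabilityMeasure_cueMeasure (N : ℕ) : IsProbabilityMeasure (cueMeasure N) := by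
  constructor
  rw [cueMeasure, withDensity_apply _ MeasurableSet.univ, Measure.restrict_univ,
    ← ofReal_integral_eq_lintegral_ofReal ((integrable_cueWeight N).div_const _)
      (ae_of_all _ fun θ => div_nonneg (cueWeight_nonneg N θ) (cueZ_pos N).le),
    integral_div]
  change ENNReal.ofReal (cueZ N / cueZ N) = 1
  rw [div_self (cueZ_pos N).ne', ENNReal.ofReal_one]

/-- The pair counting statistic `S_N(f) = ∑_{i ≠ j} f(θ_i - θ_j)`, over ordered pairs. -/
def pairStat (f : Torus → ℝ) (N : ℕ) (θ : Fin N → Torus) : ℝ :=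
  ∑ p ∈ (Finset.univ : Finset (Fin N)).offDiag, f (θ p.1 - θ p.2)

/-- `V_N = ∑_{|k| ≤ N} |f̂(k)|² k²`, where `f̂(k) = (2π)⁻¹ ∫_𝕋 f(x) e^{-ikx} dx`. -/
def truncVar (f : Torus → ℝ) (N : ℕ) : ℝ :=
  ∑ k ∈ Finset.Icc (-(N : ℤ)) (N : ℤ), ‖fourierCoeff (fun x => (f x : ℂ)) k‖ ^ 2 * (k : ℝ) ^ 2

/-- An (eventually) positive sequence is slowly varying in the sense of Karamata if
`V_{⌊cN⌋} / V_N → 1` for every real `c > 0`. -/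
def SlowlyVarying (V : ℕ → ℝ) : Prop :=
  (∀ᶠ N in atTop, 0 < V N) ∧
    ∀ c : ℝ, 0 < c → Tendsto (fun N : ℕ => V ⌊c * (N : ℝ)⌋₊ / V N) atTop (𝓝 1)

end PairCUE

end

/-!
Write `T_k = ∑_j e^{i k θ_j}`. For an even trigonometric polynomial, up to an additive constant,
`S_N(f) = 2 ∑_{k ≥ 1} f̂(k) |T_k|²`, and a general `f` is a limit of such polynomials in mean, so
that the theorem concerns the joint law of the `|T_k|²`. For `k` small compared to `N` these behave
like independent exponential variables of mean `k`, and a linear combination of such variables with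
no dominant term is asymptotically Gaussian; the frequencies comparable to `N` or larger are
negligible because `V_N` varies slowly.

All expectations are computed in the basis of alternants `A_α = det (e^{i α_j θ_l})`. The density of
the CUE is `|A_δ|² / Z_N` with `δ = (0, …, N - 1)`, alternants whose exponents are not permutations
of each other are orthogonal, and multiplication by `T_k` shifts the exponents one at a time, by `k`
(`powerSum_mul_alternant`). Two facts result.

* *Variance* (`exists_integral_sum_norm_sq_powerSum_le`). Up to a multiple of `A_δ`,
  `∑ c_k |T_k|² A_δ` is a combination of the alternants obtained from `δ` by moving one exponent
  out at the top and another one out at the bottom. Each set of exponents arises at most twice, so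
  that the variance of `∑ c_k |T_k|²` is at most `2 ∑ c_k² min(k, N)²`.
* *Moments* (`integral_prod_norm_sq_powerSum_pow`). On polynomial alternants of degree small
  compared to `N`, the adjoint of `T_k` satisfies `[T_k^*, T_l] = k δ_{kl}`
  (`alternantSum_commutator`), hence `E ∏ |T_k|^{2 a_k} = ∏ k^{a_k} a_k!` if `∑ k a_k ≤ N`.

Fix an even `m`. By the second fact, `∑_{k ≤ N/m} b_k (|T_k|² / k - 1)` has the same first `m`
moments as `∑ b_k (E_k - 1)` with independent standard exponential variables `E_k`. The latter sum
has a moment generating function bounded uniformly in `N` near any given point once the `b_k` are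
small, so that the two characteristic functions differ at a given point by `O(2^{-m})`
(`norm_charFun_traceSq_sub_le`). Slow variation shows that no single term dominates
(`eventually_sq_mul_le`) and that the frequencies `k > N/m` contribute `o(V_N)` to the variance
bound (`eventually_sum_min_sq_le`). Letting `N → ∞` and then `m → ∞` gives convergence of the
characteristic functions (`tendsto_charFun_normalizedStat`), and Lévy's theorem concludes.
-/

noncomputable section

namespace PairCUE

open scoped ComplexConjugate

/-! ### Alternants on the torus -/

/-- The alternant `A_α(θ) = det (e^{i α_j θ_k})_{j,k}` with integer exponents `α`. -/
def alternant {N : ℕ} (α : Fin N → ℤ) (θ : Fin N → Torus) : ℂ :=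
  Matrix.det (Matrix.of fun i j => fourier (α i) (θ j))

/-- The power sum `T_k(θ) = ∑_j e^{i k θ_j}`, the trace of the `k`-th power of the unitary matrix
with eigenangles `θ`. -/
def powerSum {N : ℕ} (k : ℤ) (θ : Fin N → Torus) : ℂ := ∑ i, fourier k (θ i)

/-- The exponents `0, 1, …, N - 1` of the Vandermonde determinant. -/
def vacuum (N : ℕ) : Fin N → ℤ := fun i => (i : ℤ)

theorem vacuum_injective (N : ℕ) : Function.Injective (vacuum N) := fun i j h => by
  simpa [vacuum, Fin.ext_iff] using h

theorem alternant_eq_sum {N : ℕ} (α : Fin N → ℤ) (θ : Fin N → Torus) :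
    alternant α θ =
      ∑ σ : Equiv.Perm (Fin N), ((Equiv.Perm.sign σ : ℤ) : ℂ) * ∏ j, fourier (α (σ j)) (θ j) := by
  rw [alternant, Matrix.det_apply']
  rfl

theorem alternant_of_not_injective {N : ℕ} {α : Fin N → ℤ} (h : ¬ Function.Injective α)
    (θ : Fin N → Torus) : alternant α θ = 0 := by
  simp only [Function.Injective, not_forall] at h
  obtain ⟨i, j, hij, hne⟩ := h
  refine Matrix.det_zero_of_row_eq hne ?_
  ext k
  simp [hij]

theorem alternant_comp_perm {N : ℕ} (α : Fin N → ℤ) (σ : Equiv.Perm (Fin N)) (θ : Fin N → Torus) :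
    alternant (α ∘ σ) θ = ((Equiv.Perm.sign σ : ℤ) : ℂ) * alternant α θ :=
  Matrix.det_permute σ (Matrix.of fun i j => fourier (α i) (θ j))

theorem continuous_alternant {N : ℕ} (α : Fin N → ℤ) : Continuous (alternant α) := by
  refine Continuous.matrix_det (continuous_matrix fun i j => ?_)
  exact (fourier (α i)).continuous.comp (continuous_apply j)

theorem continuous_powerSum {N : ℕ} (k : ℤ) :
    Continuous (powerSum k : (Fin N → Torus) → ℂ) :=
  continuous_finsetSum _ fun j _ => (fourier k).continuous.comp (continuous_apply j)

theorem integrable_of_continuous {N : ℕ} {E : Type*} [NormedAddCommGroup E]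
    {g : (Fin N → Torus) → E} (hg : Continuous g) :
    Integrable g (volume : Measure (Fin N → Torus)) :=
  hg.integrable_of_hasCompactSupport (HasCompactSupport.of_compactSpace _)

theorem conj_powerSum {N : ℕ} (k : ℤ) (θ : Fin N → Torus) :
    conj (powerSum k θ) = powerSum (-k) θ := by
  simp only [powerSum, map_sum, fourier_neg]

/-- Multiplying an alternant by a power sum shifts one exponent at a time. -/
theorem powerSum_mul_alternant {N : ℕ} (k : ℤ) (α : Fin N → ℤ) (θ : Fin N → Torus) :
    powerSum k θ * alternant α θ = ∑ i, alternant (α + Pi.single i k) θ := by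
  simp only [alternant_eq_sum, powerSum]
  rw [Finset.sum_comm, Finset.mul_sum]
  refine Finset.sum_congr rfl fun σ _ => ?_
  rw [← Finset.mul_sum, mul_left_comm]
  congr 1
  rw [Finset.sum_mul]
  refine Eq.trans ?_ (Equiv.sum_comp σ _)
  refine Finset.sum_congr rfl fun i _ => ?_
  rw [← Finset.mul_prod_erase _ _ (Finset.mem_univ i),
    ← Finset.mul_prod_erase _ _ (Finset.mem_univ i), ← mul_assoc]
  congr 1
  · simp only [Pi.add_apply, Pi.single_eq_same, fourier_add]
    ring
  · refine Finset.prod_congr rfl fun j hj => ?_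
    have : σ j ≠ σ i := fun h => (Finset.ne_of_mem_erase hj) (σ.injective h)
    simp [Pi.single_eq_of_ne this]

theorem integral_fourier (n : ℤ) :
    ∫ x : Torus, fourier n x = if n = 0 then ((2 * Real.pi : ℝ) : ℂ) else 0 := by
  have h := congrFun (fourierCoeff_fourier (T := 2 * Real.pi) n) 0
  rw [fourierCoeff, AddCircle.integral_haarAddCircle] at h
  simp only [neg_zero, fourier_zero, one_smul] at h
  have h2 : (2 * Real.pi : ℝ) ≠ 0 := Real.two_pi_pos.ne'
  rw [inv_smul_eq_iff₀ h2] at h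
  rw [h]
  by_cases hn : n = 0
  · subst hn
    simp
  · simp [hn]

theorem integral_prod_fourier {N : ℕ} (α : Fin N → ℤ) :
    ∫ θ : Fin N → Torus, ∏ j, fourier (α j) (θ j)
      = if α = 0 then ((2 * Real.pi : ℝ) : ℂ) ^ N else 0 := by
  rw [integral_fintype_prod_volume_eq_prod (f := fun j (x : Torus) => fourier (α j) x)]
  simp only [integral_fourier]
  by_cases h : α = 0
  · simp [h]
  · rw [if_neg h]
    obtain ⟨j, hj⟩ := Function.ne_iff.mp h
    exact Finset.prod_eq_zero (Finset.mem_univ j) (if_neg hj)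

theorem integral_conj_alternant_mul {N : ℕ} (α β : Fin N → ℤ) :
    ∫ θ : Fin N → Torus, conj (alternant α θ) * alternant β θ
      = ∑ σ : Equiv.Perm (Fin N), ∑ τ : Equiv.Perm (Fin N),
          ((Equiv.Perm.sign σ : ℤ) : ℂ) * ((Equiv.Perm.sign τ : ℤ) : ℂ) *
            if β ∘ τ = α ∘ σ then ((2 * Real.pi : ℝ) : ℂ) ^ N else 0 := by
  have h (θ : Fin N → Torus) : conj (alternant α θ) * alternant β θ
      = ∑ σ : Equiv.Perm (Fin N), ∑ τ : Equiv.Perm (Fin N),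
          ((Equiv.Perm.sign σ : ℤ) : ℂ) * ((Equiv.Perm.sign τ : ℤ) : ℂ) *
            ∏ j, fourier ((β ∘ τ - α ∘ σ) j) (θ j) := by
    rw [alternant_eq_sum, alternant_eq_sum, map_sum, Finset.sum_mul_sum]
    refine Finset.sum_congr rfl fun σ _ => Finset.sum_congr rfl fun τ _ => ?_
    simp only [map_mul, map_prod, Pi.sub_apply, Function.comp, sub_eq_add_neg, fourier_add,
      fourier_neg, Finset.prod_mul_distrib, map_intCast]
    ring
  have hc (γ : Fin N → ℤ) : Continuous fun θ : Fin N → Torus => ∏ j, fourier (γ j) (θ j) :=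
    continuous_finsetProd _ fun j _ => (fourier (γ j)).continuous.comp (continuous_apply j)
  simp only [h]
  rw [integral_finsetSum]
  swap
  · exact fun σ _ => integrable_of_continuous
      (continuous_finsetSum _ fun τ _ => continuous_const.mul (hc _))
  refine Finset.sum_congr rfl fun σ _ => ?_
  rw [integral_finsetSum]
  swap
  · exact fun τ _ => integrable_of_continuous (continuous_const.mul (hc _))
  refine Finset.sum_congr rfl fun τ _ => ?_
  rw [integral_const_mul, integral_prod_fourier]
  simp only [sub_eq_zero]

/-- Alternants whose exponents are not permutations of each other are orthogonal. -/
theorem integral_conj_alternant_mul_eq_zero {N : ℕ} {α β : Fin N → ℤ}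
    (h : Set.range α ≠ Set.range β) :
    ∫ θ : Fin N → Torus, conj (alternant α θ) * alternant β θ = 0 := by
  rw [integral_conj_alternant_mul]
  refine Finset.sum_eq_zero fun σ _ => Finset.sum_eq_zero fun τ _ => ?_
  rw [if_neg, mul_zero]
  intro h2
  have := congrArg Set.range h2
  rw [σ.surjective.range_comp, τ.surjective.range_comp] at this
  exact h this.symm

theorem integral_conj_alternant_mul_self {N : ℕ} {α : Fin N → ℤ} (h : Function.Injective α) :
    ∫ θ : Fin N → Torus, conj (alternant α θ) * alternant α θ
      = (N.factorial : ℂ) * ((2 * Real.pi : ℝ) : ℂ) ^ N := by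
  rw [integral_conj_alternant_mul]
  have h1 (σ : Equiv.Perm (Fin N)) : ∑ τ : Equiv.Perm (Fin N),
          ((Equiv.Perm.sign σ : ℤ) : ℂ) * ((Equiv.Perm.sign τ : ℤ) : ℂ) *
            (if α ∘ τ = α ∘ σ then ((2 * Real.pi : ℝ) : ℂ) ^ N else 0)
        = ((2 * Real.pi : ℝ) : ℂ) ^ N := by
    rw [Finset.sum_eq_single σ]
    · rw [if_pos rfl, ← Int.cast_mul, Int.units_coe_mul_self]
      simp
    · intro τ _ hτ
      rw [if_neg, mul_zero]
      intro h2
      exact hτ (Equiv.ext fun x => h (congrFun h2 x))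
    · simp
  simp only [h1, Finset.sum_const, Finset.card_univ, Fintype.card_perm, Fintype.card_fin,
    nsmul_eq_mul]

/-! ### The CUE expectation -/

theorem cueWeight_eq_norm_sq {N : ℕ} (θ : Fin N → Torus) :
    cueWeight N θ = ‖alternant (vacuum N) θ‖ ^ 2 := by
  have h : alternant (vacuum N) θ
      = (Matrix.vandermonde fun j => (AddCircle.toCircle (θ j) : ℂ)).det := by
    rw [← Matrix.det_transpose, alternant]
    congr 1
    ext i j
    simp [vacuum, Matrix.vandermonde, fourier_apply, AddCircle.toCircle_nsmul]
  rw [h, Matrix.det_vandermonde, cueWeight, norm_prod, ← Finset.prod_pow]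
  refine Finset.prod_congr rfl fun j _ => ?_
  rw [norm_prod, ← Finset.prod_pow]
  refine Finset.prod_congr rfl fun k _ => ?_
  rw [norm_sub_rev]

theorem cueWeight_coe {N : ℕ} (θ : Fin N → Torus) :
    (cueWeight N θ : ℂ) = conj (alternant (vacuum N) θ) * alternant (vacuum N) θ := by
  rw [cueWeight_eq_norm_sq, Complex.conj_mul']
  push_cast
  rfl

theorem cueZ_eq (N : ℕ) : cueZ N = N.factorial * (2 * Real.pi) ^ N := by
  have h : ((cueZ N : ℝ) : ℂ) = ((N.factorial * (2 * Real.pi) ^ N : ℝ) : ℂ) := by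
    rw [cueZ, ← integral_complex_ofReal]
    simp only [cueWeight_coe]
    rw [integral_conj_alternant_mul_self (vacuum_injective N)]
    push_cast
    rfl
  exact_mod_cast h

/-- Alternants with distinct exponents all have the same norm. -/
theorem integral_norm_sq_alternant {N : ℕ} {α : Fin N → ℤ} (h : Function.Injective α) :
    ∫ θ : Fin N → Torus, conj (alternant α θ) * alternant α θ = (cueZ N : ℂ) := by
  rw [integral_conj_alternant_mul_self h, cueZ_eq]
  push_cast
  rfl

theorem integral_cueMeasure {N : ℕ} {E : Type*} [NormedAddCommGroup E] [NormedSpace ℝ E]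
    (g : (Fin N → Torus) → E) :
    ∫ θ, g θ ∂(cueMeasure N) = (cueZ N)⁻¹ • ∫ θ : Fin N → Torus, cueWeight N θ • g θ := by
  rw [cueMeasure, integral_withDensity_eq_integral_toReal_smul, ← integral_smul]
  · refine integral_congr_ae (ae_of_all _ fun θ => ?_)
    simp only
    rw [ENNReal.toReal_ofReal (div_nonneg (cueWeight_nonneg N θ) (cueZ_pos N).le), smul_smul,
      div_eq_inv_mul]
  · exact ((continuous_cueWeight N).div_const _).measurable.ennreal_ofReal
  · exact ae_of_all _ fun θ => ENNReal.ofReal_lt_top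

/-- The law of the eigenangles is dominated by a multiple of Lebesgue measure. -/
theorem exists_cueMeasure_le (N : ℕ) :
    ∃ C : NNReal, cueMeasure N ≤ (C : ENNReal) • (volume : Measure (Fin N → Torus)) := by
  obtain ⟨C, hC⟩ := (isCompact_range (continuous_cueWeight N)).bddAbove
  refine ⟨(C / cueZ N).toNNReal, ?_⟩
  rw [cueMeasure, ← withDensity_const]
  refine withDensity_mono (ae_of_all _ fun θ => ?_)
  change ENNReal.ofReal _ ≤ ENNReal.ofReal _
  exact ENNReal.ofReal_le_ofReal
    (div_le_div_of_nonneg_right (hC (Set.mem_range_self θ)) (cueZ_pos N).le)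

theorem integrable_cueMeasure_of_continuous {N : ℕ} {E : Type*} [NormedAddCommGroup E]
    {g : (Fin N → Torus) → E} (hg : Continuous g) : Integrable g (cueMeasure N) := by
  obtain ⟨C, hC⟩ := exists_cueMeasure_le N
  exact ((integrable_of_continuous hg).smul_measure ENNReal.coe_ne_top).mono_measure hC

/-! ### The variance of a linear combination of `|T_k|²` -/

theorem integral_norm_sq_alternant_le {N : ℕ} (α : Fin N → ℤ) :
    ∫ θ : Fin N → Torus, ‖alternant α θ‖ ^ 2 ≤ cueZ N := by
  by_cases h : Function.Injective α
  · apply le_of_eq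
    have h2 := integral_norm_sq_alternant h
    simp only [Complex.conj_mul', ← Complex.ofReal_pow, integral_complex_ofReal] at h2
    exact Complex.ofReal_injective h2
  · simp [alternant_of_not_injective h, (cueZ_pos N).le]

/-- Bessel's inequality for a family of alternants that are pairwise not permutations of each
other. -/
theorem integral_norm_sq_sum_alternant_le {N : ℕ} {ι : Type*} (S : Finset ι) (c : ι → ℝ)
    (α : ι → Fin N → ℤ) (hα : ∀ s ∈ S, ∀ t ∈ S, Set.range (α s) = Set.range (α t) → s = t) :
    ∫ θ : Fin N → Torus, ‖∑ s ∈ S, (c s : ℂ) * alternant (α s) θ‖ ^ 2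
      ≤ cueZ N * ∑ s ∈ S, c s ^ 2 := by
  classical
  have hint (s t : ι) : Continuous fun θ : Fin N → Torus =>
      (c s : ℂ) * (c t : ℂ) * (conj (alternant (α s) θ) * alternant (α t) θ) :=
    continuous_const.mul ((Complex.continuous_conj.comp (continuous_alternant _)).mul
      (continuous_alternant _))
  have key : ((∫ θ : Fin N → Torus, ‖∑ s ∈ S, (c s : ℂ) * alternant (α s) θ‖ ^ 2 : ℝ) : ℂ)
      = ((∑ s ∈ S, c s ^ 2 * ∫ θ : Fin N → Torus, ‖alternant (α s) θ‖ ^ 2 : ℝ) : ℂ) := by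
    rw [← integral_complex_ofReal]
    push_cast
    have h1 (θ : Fin N → Torus) : ((‖∑ s ∈ S, (c s : ℂ) * alternant (α s) θ‖ : ℂ)) ^ 2
        = ∑ s ∈ S, ∑ t ∈ S, (c s : ℂ) * (c t : ℂ) *
            (conj (alternant (α s) θ) * alternant (α t) θ) := by
      rw [← Complex.conj_mul', map_sum, Finset.sum_mul_sum]
      refine Finset.sum_congr rfl fun s _ => Finset.sum_congr rfl fun t _ => ?_
      rw [map_mul, Complex.conj_ofReal]
      ring
    simp only [h1]
    rw [integral_finsetSum]
    swap
    · exact fun s _ => integrable_of_continuous (continuous_finsetSum _ fun t _ => hint s t)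
    refine Finset.sum_congr rfl fun s hs => ?_
    rw [integral_finsetSum]
    swap
    · exact fun t _ => integrable_of_continuous (hint s t)
    simp only [integral_const_mul]
    rw [Finset.sum_eq_single s]
    · rw [← integral_complex_ofReal]
      simp only [Complex.conj_mul']
      push_cast
      ring
    · intro t ht hts
      rw [integral_conj_alternant_mul_eq_zero fun h => hts (hα s hs t ht h).symm, mul_zero]
    · exact fun h => absurd hs h
  rw [Complex.ofReal_injective key, Finset.mul_sum]
  refine Finset.sum_le_sum fun s _ => ?_
  rw [mul_comm]
  exact mul_le_mul_of_nonneg_right (integral_norm_sq_alternant_le _) (sq_nonneg _)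

/-- The exponents obtained from `0, …, N - 1` by moving `x` up and `y` down by `k`. -/
def pairShift {N : ℕ} (k : ℕ) (x y : Fin N) : Fin N → ℤ :=
  vacuum N + Pi.single y (-(k : ℤ)) + Pi.single x (k : ℤ)

theorem pairShift_left {N : ℕ} (k : ℕ) {x y : Fin N} (h : x ≠ y) :
    pairShift k x y x = (x : ℤ) + k := by
  simp [pairShift, vacuum, Pi.single_eq_of_ne h]

theorem pairShift_right {N : ℕ} (k : ℕ) {x y : Fin N} (h : x ≠ y) :
    pairShift k x y y = (y : ℤ) - k := by
  simp [pairShift, vacuum, Pi.single_eq_of_ne h.symm, sub_eq_add_neg]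

theorem pairShift_of_ne {N : ℕ} (k : ℕ) {x y z : Fin N} (hx : z ≠ x) (hy : z ≠ y) :
    pairShift k x y z = (z : ℤ) := by
  simp [pairShift, vacuum, Pi.single_eq_of_ne hx, Pi.single_eq_of_ne hy]

/-- Unless `x` leaves `0, …, N - 1` at the top and `y` leaves it at the bottom, moving `x` up and
`y` down by `k` leads back to a multiple of the Vandermonde determinant. -/
theorem alternant_pairShift {N : ℕ} {k : ℕ} (hk : 0 < k) (x y : Fin N)
    (h : ¬ (x ≠ y ∧ N ≤ (x : ℕ) + k ∧ (y : ℕ) < k)) :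
    ∃ e : ℝ, ∀ θ, alternant (pairShift k x y) θ = (e : ℂ) * alternant (vacuum N) θ := by
  by_cases hxy : x = y
  · subst hxy
    refine ⟨1, fun θ => ?_⟩
    have : pairShift k x x = vacuum N := by
      simp [pairShift, add_assoc, ← Pi.single_add]
    simp [this]
  by_cases hs : (x : ℕ) + k = y
  · refine ⟨-1, fun θ => ?_⟩
    have : pairShift k x y = vacuum N ∘ Equiv.swap x y := by
      ext z
      by_cases hzx : z = x
      · subst hzx
        rw [pairShift_left k hxy]
        simp [vacuum, ← hs]
      by_cases hzy : z = y
      · subst hzy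
        rw [pairShift_right k hxy]
        simp [vacuum, ← hs]
      rw [pairShift_of_ne k hzx hzy]
      simp [vacuum, Equiv.swap_apply_of_ne_of_ne hzx hzy]
    rw [this, alternant_comp_perm, Equiv.Perm.sign_swap hxy]
    simp
  refine ⟨0, fun θ => ?_⟩
  rw [Complex.ofReal_zero, zero_mul]
  refine alternant_of_not_injective (fun hinj => ?_) θ
  by_cases hN : N ≤ (x : ℕ) + k
  · have hy : k ≤ (y : ℕ) := by
      by_contra hlt
      exact h ⟨hxy, hN, not_le.mp hlt⟩
    have hzx : (⟨(y : ℕ) - k, by omega⟩ : Fin N) ≠ x := by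
      intro he
      have := congrArg Fin.val he
      simp only at this
      omega
    have hzy : (⟨(y : ℕ) - k, by omega⟩ : Fin N) ≠ y := by
      intro he
      have := congrArg Fin.val he
      simp only at this
      omega
    refine hzy (hinj ?_)
    rw [pairShift_of_ne k hzx hzy, pairShift_right k hxy]
    simp only
    omega
  · have hzx : (⟨(x : ℕ) + k, by omega⟩ : Fin N) ≠ x := by
      intro he
      have := congrArg Fin.val he
      simp only at this
      omega
    have hzy : (⟨(x : ℕ) + k, by omega⟩ : Fin N) ≠ y := by
      intro he
      have := congrArg Fin.val he
      simp only at this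
      omega
    refine hzx (hinj ?_)
    rw [pairShift_of_ne k hzx hzy, pairShift_left k hxy]
    simp only
    omega

/-- The holes and the particles of a two-particle excitation determine it up to exchanging the
two holes. -/
theorem eq_of_range_pairShift_eq {N : ℕ} {k k' : ℕ} {x y x' y' : Fin N}
    (h : x ≠ y) (hx : N ≤ (x : ℕ) + k) (hy : (y : ℕ) < k)
    (h' : x' ≠ y') (hx' : N ≤ (x' : ℕ) + k') (hy' : (y' : ℕ) < k')
    (hr : Set.range (pairShift k x y) = Set.range (pairShift k' x' y')) (ho : x < y ↔ x' < y') :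
    k = k' ∧ x = x' ∧ y = y' := by
  have hole (w : Fin N) (hw : w ≠ x' ∧ w ≠ y') : (w : ℤ) ∈ Set.range (pairShift k x y) := by
    rw [hr]
    exact ⟨w, pairShift_of_ne k' hw.1 hw.2⟩
  have nothole (w : Fin N) (hw : w = x ∨ w = y) : (w : ℤ) ∉ Set.range (pairShift k x y) := by
    rintro ⟨z, hz⟩
    by_cases hzx : z = x
    · subst hzx
      rw [pairShift_left k h] at hz
      have := w.isLt
      omega
    by_cases hzy : z = y
    · subst hzy
      rw [pairShift_right k h] at hz
      omega
    rw [pairShift_of_ne k hzx hzy] at hz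
    have : z = w := Fin.ext (by exact_mod_cast hz)
    subst this
    exact hw.elim hzx hzy
  have hxc : x = x' ∨ x = y' := by
    by_contra hc
    push Not at hc
    exact nothole x (Or.inl rfl) (hole x hc)
  have hyc : y = x' ∨ y = y' := by
    by_contra hc
    push Not at hc
    exact nothole y (Or.inr rfl) (hole y hc)
  have hxx : x = x' ∧ y = y' := by
    rcases hxc with h1 | h1 <;> rcases hyc with h2 | h2
    · exact absurd (h1.trans h2.symm) h
    · exact ⟨h1, h2⟩
    · subst h1 h2
      rcases lt_or_gt_of_ne h with h3 | h3
      · exact absurd (ho.mp h3) (not_lt.mpr h3.le)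
      · exact absurd (ho.mpr h3) (not_lt.mpr h3.le)
    · exact absurd (h1.trans h2.symm) h
  refine ⟨?_, hxx⟩
  obtain ⟨rfl, rfl⟩ := hxx
  have hm : pairShift k x y x ∈ Set.range (pairShift k' x y) := by
    rw [← hr]
    exact Set.mem_range_self x
  obtain ⟨z, hz⟩ := hm
  rw [pairShift_left k h] at hz
  by_cases hzx : z = x
  · subst hzx
    rw [pairShift_left k' h] at hz
    omega
  by_cases hzy : z = y
  · subst hzy
    rw [pairShift_right k' h] at hz
    omega
  rw [pairShift_of_ne k' hzx hzy] at hz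
  have := z.isLt
  omega

/-- The moves `(k, x, y)` that take `x` out at the top and `y` out at the bottom of
`0, …, N - 1`. -/
def excitations (N : ℕ) (s : Finset ℕ) : Finset (ℕ × Fin N × Fin N) :=
  (s ×ˢ Finset.univ).filter fun q => q.2.1 ≠ q.2.2 ∧ N ≤ (q.2.1 : ℕ) + q.1 ∧ (q.2.2 : ℕ) < q.1

theorem mem_excitations {N : ℕ} {s : Finset ℕ} {q : ℕ × Fin N × Fin N} :
    q ∈ excitations N s ↔
      q.1 ∈ s ∧ q.2.1 ≠ q.2.2 ∧ N ≤ (q.2.1 : ℕ) + q.1 ∧ (q.2.2 : ℕ) < q.1 := by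
  simp [excitations]

theorem sum_excitations_le {N : ℕ} (s : Finset ℕ) (c : ℕ → ℝ) :
    ∑ q ∈ excitations N s, c q.1 ^ 2 ≤ ∑ k ∈ s, c k ^ 2 * (min k N : ℕ) ^ 2 := by
  rw [excitations, Finset.sum_filter, Finset.sum_product]
  refine Finset.sum_le_sum fun k _ => ?_
  simp only
  rw [← Finset.sum_filter, Finset.sum_const, nsmul_eq_mul, mul_comm]
  refine mul_le_mul_of_nonneg_left ?_ (sq_nonneg _)
  rw [sq]
  have hsub : (Finset.univ.filter fun p : Fin N × Fin N =>
      p.1 ≠ p.2 ∧ N ≤ (p.1 : ℕ) + k ∧ (p.2 : ℕ) < k) ⊆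
      (Finset.univ.filter fun x : Fin N => N ≤ (x : ℕ) + k) ×ˢ
        (Finset.univ.filter fun y : Fin N => (y : ℕ) < k) := by
    intro p hp
    simp only [Finset.mem_filter, Finset.mem_univ, true_and, Finset.mem_product] at hp ⊢
    exact hp.2
  have h1 : (Finset.univ.filter fun x : Fin N => N ≤ (x : ℕ) + k).card ≤ min k N := by
    refine le_min ?_ ((Finset.card_filter_le _ _).trans (by simp))
    have : ((Finset.univ.filter fun x : Fin N => N ≤ (x : ℕ) + k).image fun x : Fin N => (x : ℕ))
        ⊆ Finset.Ico (N - k) N := by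
      intro v hv
      simp only [Finset.mem_image, Finset.mem_filter, Finset.mem_univ, true_and] at hv
      obtain ⟨x, hx, rfl⟩ := hv
      simp only [Finset.mem_Ico]
      have := x.isLt
      omega
    have h2 := Finset.card_le_card this
    rw [Finset.card_image_of_injective _ Fin.val_injective, Nat.card_Ico] at h2
    omega
  have h2 : (Finset.univ.filter fun y : Fin N => (y : ℕ) < k).card ≤ min k N := by
    refine le_min ?_ ((Finset.card_filter_le _ _).trans (by simp))
    have : ((Finset.univ.filter fun x : Fin N => (x : ℕ) < k).image fun x : Fin N => (x : ℕ))
        ⊆ Finset.range k := by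
      intro v hv
      simp only [Finset.mem_image, Finset.mem_filter, Finset.mem_univ, true_and] at hv
      obtain ⟨x, hx, rfl⟩ := hv
      simpa using hx
    have h2 := Finset.card_le_card this
    rwa [Finset.card_image_of_injective _ Fin.val_injective, Finset.card_range] at h2
  have h3 := (Finset.card_le_card hsub).trans ((Finset.card_product _ _).le.trans
    (Nat.mul_le_mul h1 h2))
  exact_mod_cast h3

/-- Up to a multiple of the Vandermonde determinant, `∑ c_k |T_k|²` acts on it by creating
two-particle excitations. -/
theorem exists_sum_norm_sq_powerSum_mul {N : ℕ} (s : Finset ℕ) (hs : ∀ k ∈ s, 0 < k)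
    (c : ℕ → ℝ) :
    ∃ a : ℝ, ∀ θ : Fin N → Torus,
      (((∑ k ∈ s, c k * ‖powerSum (k : ℤ) θ‖ ^ 2 - a : ℝ)) : ℂ) * alternant (vacuum N) θ
        = ∑ q ∈ excitations N s, (c q.1 : ℂ) * alternant (pairShift q.1 q.2.1 q.2.2) θ := by
  have h (q : ℕ × Fin N × Fin N) : ∃ e : ℝ, q.1 ∈ s → q ∉ excitations N s → ∀ θ,
      alternant (pairShift q.1 q.2.1 q.2.2) θ = (e : ℂ) * alternant (vacuum N) θ := by
    by_cases hq : q.1 ∈ s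
    · by_cases hq2 : q ∈ excitations N s
      · exact ⟨0, fun _ h => absurd hq2 h⟩
      · rw [mem_excitations, not_and] at hq2
        obtain ⟨e, he⟩ := alternant_pairShift (hs _ hq) q.2.1 q.2.2 (hq2 hq)
        exact ⟨e, fun _ _ => he⟩
    · exact ⟨0, fun h => absurd h hq⟩
  choose e he using h
  refine ⟨∑ q ∈ (s ×ˢ Finset.univ) \ excitations N s, c q.1 * e q, fun θ => ?_⟩
  have h1 : ((∑ k ∈ s, c k * ‖powerSum (k : ℤ) θ‖ ^ 2 : ℝ) : ℂ) * alternant (vacuum N) θ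
      = ∑ q ∈ s ×ˢ (Finset.univ : Finset (Fin N × Fin N)),
          (c q.1 : ℂ) * alternant (pairShift q.1 q.2.1 q.2.2) θ := by
    rw [Finset.sum_product, Complex.ofReal_sum, Finset.sum_mul]
    refine Finset.sum_congr rfl fun k _ => ?_
    simp only
    push_cast
    rw [← Finset.mul_sum, mul_assoc]
    congr 1
    rw [← Complex.mul_conj', conj_powerSum, mul_assoc, powerSum_mul_alternant, Finset.mul_sum,
      ← Finset.univ_product_univ, Finset.sum_product_right]
    refine Finset.sum_congr rfl fun y _ => ?_
    rw [powerSum_mul_alternant]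
    rfl
  have hsub : excitations N s ⊆ s ×ˢ Finset.univ := Finset.filter_subset _ _
  have h2 : ∑ q ∈ (s ×ˢ Finset.univ) \ excitations N s,
        (c q.1 : ℂ) * alternant (pairShift q.1 q.2.1 q.2.2) θ
      = ((∑ q ∈ (s ×ˢ Finset.univ) \ excitations N s, c q.1 * e q : ℝ) : ℂ)
        * alternant (vacuum N) θ := by
    push_cast
    rw [Finset.sum_mul]
    refine Finset.sum_congr rfl fun q hq => ?_
    rw [Finset.mem_sdiff, Finset.mem_product] at hq
    rw [he q hq.1.1 hq.2 θ, mul_assoc]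
  rw [← Finset.sum_sdiff hsub, h2] at h1
  rw [Complex.ofReal_sub, sub_mul, h1, add_sub_cancel_left]

/-- The variance of `∑ c_k |T_k|²` is at most `2 ∑ c_k² min(k, N)²`. -/
theorem exists_integral_sum_norm_sq_powerSum_le {N : ℕ} (s : Finset ℕ) (hs : ∀ k ∈ s, 0 < k)
    (c : ℕ → ℝ) :
    ∃ a : ℝ, ∫ θ, (∑ k ∈ s, c k * ‖powerSum (k : ℤ) θ‖ ^ 2 - a) ^ 2 ∂(cueMeasure N)
      ≤ 2 * ∑ k ∈ s, c k ^ 2 * (min k N : ℕ) ^ 2 := by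
  obtain ⟨a, ha⟩ := exists_sum_norm_sq_powerSum_mul (N := N) s hs c
  refine ⟨a, ?_⟩
  rw [integral_cueMeasure, smul_eq_mul, inv_mul_le_iff₀ (cueZ_pos N)]
  -- The excitations with a given order of the two holes are orthogonal to each other.
  set P := (excitations N s).filter fun q => q.2.1 < q.2.2 with hP
  set Q := (excitations N s).filter fun q => ¬ q.2.1 < q.2.2 with hQ
  set g : Finset (ℕ × Fin N × Fin N) → (Fin N → Torus) → ℂ := fun R θ =>
    ∑ q ∈ R, (c q.1 : ℂ) * alternant (pairShift q.1 q.2.1 q.2.2) θ with hg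
  have hgc (R) : Continuous (g R) :=
    continuous_finsetSum _ fun q _ => continuous_const.mul (continuous_alternant _)
  have hpt (θ : Fin N → Torus) :
      cueWeight N θ • (∑ k ∈ s, c k * ‖powerSum (k : ℤ) θ‖ ^ 2 - a) ^ 2
        ≤ 2 * (‖g P θ‖ ^ 2 + ‖g Q θ‖ ^ 2) := by
    have h1 : cueWeight N θ • (∑ k ∈ s, c k * ‖powerSum (k : ℤ) θ‖ ^ 2 - a) ^ 2
        = ‖g P θ + g Q θ‖ ^ 2 := by
      rw [hg]
      simp only
      rw [hP, hQ, Finset.sum_filter_add_sum_filter_not, ← ha θ, norm_mul, Complex.norm_real,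
        mul_pow, Real.norm_eq_abs, sq_abs, cueWeight_eq_norm_sq, smul_eq_mul, mul_comm]
    rw [h1]
    have h2 := norm_add_le (g P θ) (g Q θ)
    have h3 := sq_nonneg (‖g P θ‖ - ‖g Q θ‖)
    have h4 := pow_le_pow_left₀ (norm_nonneg _) h2 2
    nlinarith
  have hgi (R) : Integrable (fun θ : Fin N → Torus => ‖g R θ‖ ^ 2) volume :=
    integrable_of_continuous ((hgc R).norm.pow 2)
  have hbes (R : Finset (ℕ × Fin N × Fin N)) (hR : R ⊆ excitations N s)
      (hord : ∀ q ∈ R, ∀ q' ∈ R, (q.2.1 < q.2.2 ↔ q'.2.1 < q'.2.2)) :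
      ∫ θ : Fin N → Torus, ‖g R θ‖ ^ 2 ≤ cueZ N * ∑ q ∈ R, c q.1 ^ 2 := by
    refine integral_norm_sq_sum_alternant_le R (fun q => c q.1)
      (fun q => pairShift q.1 q.2.1 q.2.2) fun q hq q' hq' hr => ?_
    have h1 := (mem_excitations.mp (hR hq)).2
    have h2 := (mem_excitations.mp (hR hq')).2
    obtain ⟨e1, e2, e3⟩ := eq_of_range_pairShift_eq h1.1 h1.2.1 h1.2.2 h2.1 h2.2.1 h2.2.2 hr
      (hord q hq q' hq')
    exact Prod.ext e1 (Prod.ext e2 e3)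
  have hbP := hbes P (Finset.filter_subset _ _) fun q hq q' hq' =>
    iff_of_true (Finset.mem_filter.mp hq).2 (Finset.mem_filter.mp hq').2
  have hbQ := hbes Q (Finset.filter_subset _ _) fun q hq q' hq' =>
    iff_of_false (Finset.mem_filter.mp hq).2 (Finset.mem_filter.mp hq').2
  have hcont : Continuous fun θ : Fin N → Torus =>
      cueWeight N θ • (∑ k ∈ s, c k * ‖powerSum (k : ℤ) θ‖ ^ 2 - a) ^ 2 :=
    (continuous_cueWeight N).smul (((continuous_finsetSum _ fun k _ =>
      continuous_const.mul ((continuous_powerSum _).norm.pow 2)).sub continuous_const).pow 2)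
  calc ∫ θ : Fin N → Torus, cueWeight N θ • (∑ k ∈ s, c k * ‖powerSum (k : ℤ) θ‖ ^ 2 - a) ^ 2
      ≤ ∫ θ : Fin N → Torus, 2 * (‖g P θ‖ ^ 2 + ‖g Q θ‖ ^ 2) :=
        integral_mono (integrable_of_continuous hcont)
          (integrable_of_continuous (continuous_const.mul
            (((hgc P).norm.pow 2).add ((hgc Q).norm.pow 2)))) hpt
    _ = 2 * (∫ θ : Fin N → Torus, ‖g P θ‖ ^ 2) + 2 * ∫ θ : Fin N → Torus, ‖g Q θ‖ ^ 2 := by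
        rw [integral_const_mul, integral_add (hgi P) (hgi Q), mul_add]
    _ ≤ 2 * (cueZ N * ∑ q ∈ P, c q.1 ^ 2) + 2 * (cueZ N * ∑ q ∈ Q, c q.1 ^ 2) := by gcongr
    _ = cueZ N * (2 * ∑ q ∈ excitations N s, c q.1 ^ 2) := by
        rw [hP, hQ, ← Finset.sum_filter_add_sum_filter_not (excitations N s)
          (fun q => q.2.1 < q.2.2)]
        ring
    _ ≤ cueZ N * (2 * ∑ k ∈ s, c k ^ 2 * (min k N : ℕ) ^ 2) := by
        gcongr
        · exact (cueZ_pos N).le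
        · exact sum_excitations_le s c

/-! ### Joint moments of the `|T_k|²` -/

/-- The combination of alternants given by a formal combination of exponents. -/
def alternantSum (N : ℕ) : ((Fin N → ℤ) →₀ ℂ) →ₗ[ℂ] ((Fin N → Torus) → ℂ) :=
  Finsupp.linearCombination ℂ alternant

/-- The creation operator `[α] ↦ ∑_i [α + l e_i]`; it represents multiplication by `T_l`. -/
def raise (N : ℕ) (l : ℤ) : ((Fin N → ℤ) →₀ ℂ) →ₗ[ℂ] ((Fin N → ℤ) →₀ ℂ) :=
  Finsupp.linearCombination ℂ fun α => ∑ i, Finsupp.single (α + Pi.single i l) 1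

/-- The annihilation operator `[α] ↦ ∑_{α_i ≥ k} [α - k e_i]`; it represents multiplication by
`T_{-k}` followed by the projection to nonnegative exponents. -/
def lower (N : ℕ) (k : ℤ) : ((Fin N → ℤ) →₀ ℂ) →ₗ[ℂ] ((Fin N → ℤ) →₀ ℂ) :=
  Finsupp.linearCombination ℂ fun α =>
    ∑ i, if k ≤ α i then Finsupp.single (α + Pi.single i (-k)) 1 else 0

/-- The part of the multiplication by `T_{-k}` that `lower` leaves out. -/
def lowerNeg (N : ℕ) (k : ℤ) : ((Fin N → ℤ) →₀ ℂ) →ₗ[ℂ] ((Fin N → ℤ) →₀ ℂ) :=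
  Finsupp.linearCombination ℂ fun α =>
    ∑ i, if k ≤ α i then 0 else Finsupp.single (α + Pi.single i (-k)) 1

theorem alternantSum_single {N : ℕ} (α : Fin N → ℤ) (θ : Fin N → Torus) :
    alternantSum N (Finsupp.single α 1) θ = alternant α θ := by
  simp [alternantSum, Finsupp.linearCombination_single]

theorem raise_single {N : ℕ} (l : ℤ) (α : Fin N → ℤ) :
    raise N l (Finsupp.single α 1) = ∑ i, Finsupp.single (α + Pi.single i l) 1 := by
  simp [raise, Finsupp.linearCombination_single]

theorem lower_single {N : ℕ} (k : ℤ) (α : Fin N → ℤ) :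
    lower N k (Finsupp.single α 1) =
      ∑ i, if k ≤ α i then Finsupp.single (α + Pi.single i (-k)) 1 else 0 := by
  simp [lower, Finsupp.linearCombination_single]

theorem lowerNeg_single {N : ℕ} (k : ℤ) (α : Fin N → ℤ) :
    lowerNeg N k (Finsupp.single α 1) =
      ∑ i, if k ≤ α i then 0 else Finsupp.single (α + Pi.single i (-k)) 1 := by
  simp [lowerNeg, Finsupp.linearCombination_single]

theorem lower_add_lowerNeg {N : ℕ} (k : ℤ) : lower N k + lowerNeg N k = raise N (-k) := by
  refine Finsupp.lhom_ext' fun α => LinearMap.ext_ring ?_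
  simp only [LinearMap.add_comp, LinearMap.add_apply, LinearMap.comp_apply,
    Finsupp.lsingle_apply, lower_single, lowerNeg_single, raise_single]
  rw [← Finset.sum_add_distrib]
  refine Finset.sum_congr rfl fun i _ => ?_
  split_ifs <;> simp

theorem alternantSum_raise {N : ℕ} (l : ℤ) (v : (Fin N → ℤ) →₀ ℂ) (θ : Fin N → Torus) :
    alternantSum N (raise N l v) θ = powerSum l θ * alternantSum N v θ := by
  have h : (LinearMap.proj θ ∘ₗ alternantSum N ∘ₗ raise N l : ((Fin N → ℤ) →₀ ℂ) →ₗ[ℂ] ℂ)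
      = powerSum l θ • (LinearMap.proj θ ∘ₗ alternantSum N) := by
    refine Finsupp.lhom_ext' fun α => LinearMap.ext_ring ?_
    simp only [LinearMap.comp_apply, LinearMap.smul_apply, Finsupp.lsingle_apply, raise_single,
      map_sum, LinearMap.proj_apply, alternantSum_single, smul_eq_mul, powerSum_mul_alternant]
  exact LinearMap.congr_fun h v

theorem continuous_alternantSum {N : ℕ} (v : (Fin N → ℤ) →₀ ℂ) :
    Continuous (alternantSum N v) := by
  have : alternantSum N v = fun θ => ∑ α ∈ v.support, v α * alternant α θ := by
    ext θ
    simp [alternantSum, Finsupp.linearCombination_apply, Finsupp.sum]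
  rw [this]
  exact continuous_finsetSum _ fun α _ => continuous_const.mul (continuous_alternant α)

/-- The exponents of polynomial alternants of degree `d` above that of the Vandermonde
determinant. -/
def level (N d : ℕ) : Set (Fin N → ℤ) :=
  {α | (∀ i, 0 ≤ α i) ∧ ∑ i, α i = ∑ i, vacuum N i + d}

theorem mem_supported_of_forall_single {N : ℕ} {S T : Set (Fin N → ℤ)}
    (L : ((Fin N → ℤ) →₀ ℂ) →ₗ[ℂ] ((Fin N → ℤ) →₀ ℂ))
    (h : ∀ α ∈ S, L (Finsupp.single α 1) ∈ Finsupp.supported ℂ ℂ T)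
    {v : (Fin N → ℤ) →₀ ℂ} (hv : v ∈ Finsupp.supported ℂ ℂ S) :
    L v ∈ Finsupp.supported ℂ ℂ T := by
  have h2 : Finsupp.supported ℂ ℂ S ≤ (Finsupp.supported ℂ ℂ T).comap L := by
    rw [Finsupp.supported_eq_span_single, Submodule.span_le]
    rintro _ ⟨α, hα, rfl⟩
    exact h α hα
  exact h2 hv

theorem raise_mem {N d l : ℕ} {v : (Fin N → ℤ) →₀ ℂ} (hv : v ∈ Finsupp.supported ℂ ℂ (level N d)) :
    raise N l v ∈ Finsupp.supported ℂ ℂ (level N (l + d)) := by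
  refine mem_supported_of_forall_single _ (fun α hα => ?_) hv
  rw [raise_single]
  refine Submodule.sum_mem _ fun i _ => Finsupp.single_mem_supported ℂ _ ⟨fun j => ?_, ?_⟩
  · rw [Pi.add_apply]
    refine add_nonneg (hα.1 j) ?_
    by_cases h : j = i
    · subst h
      simp
    · simp [Pi.single_eq_of_ne h]
  · simp only [Pi.add_apply, Finset.sum_add_distrib, hα.2, Finset.sum_pi_single',
      Finset.mem_univ, if_true]
    push_cast
    ring

theorem lowerNeg_mem {N : ℕ} (k : ℤ) (v : (Fin N → ℤ) →₀ ℂ) :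
    lowerNeg N k v ∈ Finsupp.supported ℂ ℂ {α : Fin N → ℤ | ∃ i, α i < 0} := by
  refine mem_supported_of_forall_single (S := Set.univ) _ (fun α _ => ?_) (by simp)
  rw [lowerNeg_single]
  refine Submodule.sum_mem _ fun i _ => ?_
  split_ifs with h
  · exact zero_mem _
  · refine Finsupp.single_mem_supported ℂ _ ⟨i, ?_⟩
    rw [Pi.add_apply, Pi.single_eq_same]
    omega

theorem integral_conj_alternantSum_mul_eq_zero {N : ℕ} {S T : Set (Fin N → ℤ)}
    (hST : ∀ α ∈ S, ∀ β ∈ T, Set.range α ≠ Set.range β) {u v : (Fin N → ℤ) →₀ ℂ}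
    (hu : u ∈ Finsupp.supported ℂ ℂ S) (hv : v ∈ Finsupp.supported ℂ ℂ T) :
    ∫ θ, conj (alternantSum N u θ) * alternantSum N v θ = 0 := by
  have h (θ : Fin N → Torus) : conj (alternantSum N u θ) * alternantSum N v θ
      = ∑ α ∈ u.support, ∑ β ∈ v.support,
          conj (u α) * v β * (conj (alternant α θ) * alternant β θ) := by
    simp only [alternantSum, Finsupp.linearCombination_apply, Finsupp.sum, Finset.sum_apply,
      Pi.smul_apply, smul_eq_mul, map_sum, map_mul, Finset.sum_mul_sum]
    refine Finset.sum_congr rfl fun α _ => Finset.sum_congr rfl fun β _ => by ring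
  have hint (α β : Fin N → ℤ) : Continuous fun θ : Fin N → Torus =>
      conj (u α) * v β * (conj (alternant α θ) * alternant β θ) :=
    continuous_const.mul ((Complex.continuous_conj.comp (continuous_alternant _)).mul
      (continuous_alternant _))
  simp only [h]
  rw [integral_finsetSum]
  swap
  · exact fun α _ => integrable_of_continuous (continuous_finsetSum _ fun β _ => hint α β)
  refine Finset.sum_eq_zero fun α hα => ?_
  rw [integral_finsetSum]
  swap
  · exact fun β _ => integrable_of_continuous (hint α β)
  refine Finset.sum_eq_zero fun β hβ => ?_
  rw [integral_const_mul, integral_conj_alternant_mul_eq_zero (hST α (hu hα) β (hv hβ)), mul_zero]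

/-- `lower k` is adjoint to the multiplication by `T_k`. -/
theorem integral_conj_mul_powerSum_neg {N d : ℕ} (k : ℤ) {u : (Fin N → ℤ) →₀ ℂ}
    (hu : u ∈ Finsupp.supported ℂ ℂ (level N d)) (v : (Fin N → ℤ) →₀ ℂ) :
    ∫ θ, conj (alternantSum N u θ) * (powerSum (-k) θ * alternantSum N v θ)
      = ∫ θ, conj (alternantSum N u θ) * alternantSum N (lower N k v) θ := by
  have hcont (w : (Fin N → ℤ) →₀ ℂ) :
      Integrable (fun θ => conj (alternantSum N u θ) * alternantSum N w θ) volume :=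
    integrable_of_continuous ((Complex.continuous_conj.comp (continuous_alternantSum u)).mul
      (continuous_alternantSum w))
  have h (θ : Fin N → Torus) : conj (alternantSum N u θ) * (powerSum (-k) θ * alternantSum N v θ)
      = conj (alternantSum N u θ) * alternantSum N (lower N k v) θ
        + conj (alternantSum N u θ) * alternantSum N (lowerNeg N k v) θ := by
    rw [← alternantSum_raise, ← lower_add_lowerNeg, LinearMap.add_apply, map_add, Pi.add_apply,
      mul_add]
  simp only [h]
  rw [integral_add (hcont _) (hcont _), add_eq_left]
  refine integral_conj_alternantSum_mul_eq_zero ?_ hu (lowerNeg_mem k v)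
  rintro α hα β ⟨i, hi⟩ hr
  have : β i ∈ Set.range α := by
    rw [hr]
    exact Set.mem_range_self i
  obtain ⟨j, hj⟩ := this
  have := hα.1 j
  omega

/-- In degree `d`, the exponents of a nonzero alternant contain `0, …, N - d - 1`. -/
theorem exists_eq_of_mem_level {N d : ℕ} {α : Fin N → ℤ} (hα : α ∈ level N d)
    (hinj : Function.Injective α) {m : ℤ} (hm : 0 ≤ m) (hmN : m + d < N) : ∃ i, α i = m := by
  by_contra hno
  push Not at hno
  set s : Finset ℤ := Finset.univ.image α with hs
  set R : Finset ℤ := Finset.univ.image (vacuum N) with hR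
  have hsum : ∑ x ∈ s, x = ∑ x ∈ R, x + d := by
    rw [hs, hR, Finset.sum_image hinj.injOn, Finset.sum_image (vacuum_injective N).injOn, hα.2]
  have hcard : s.card = R.card := by
    rw [hs, hR, Finset.card_image_of_injective _ hinj,
      Finset.card_image_of_injective _ (vacuum_injective N)]
  have hRmem (x : ℤ) : x ∈ R ↔ 0 ≤ x ∧ x < N := by
    simp only [hR, Finset.mem_image, Finset.mem_univ, true_and, vacuum]
    constructor
    · rintro ⟨i, rfl⟩
      have := i.isLt
      omega
    · rintro ⟨h1, h2⟩
      exact ⟨⟨x.toNat, by omega⟩, by simp only; omega⟩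
  have hmR : m ∈ R \ s := by
    rw [Finset.mem_sdiff, hRmem]
    refine ⟨⟨hm, by omega⟩, ?_⟩
    simp only [hs, Finset.mem_image, Finset.mem_univ, true_and, not_exists]
    exact hno
  have h1 : ∑ x ∈ s \ R, x + ∑ x ∈ s ∩ R, x = ∑ x ∈ s, x := by
    rw [add_comm]
    exact Finset.sum_inter_add_sum_sdiff _ _ _
  have h2 : ∑ x ∈ R \ s, x + ∑ x ∈ s ∩ R, x = ∑ x ∈ R, x := by
    rw [add_comm, Finset.inter_comm]
    exact Finset.sum_inter_add_sum_sdiff _ _ _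
  have h3 : (s \ R).card = (R \ s).card := by
    have e1 := Finset.card_sdiff_add_card_inter s R
    have e2 := Finset.card_sdiff_add_card_inter R s
    rw [Finset.inter_comm] at e2
    omega
  have h4 : (s \ R).card • (N : ℤ) ≤ ∑ x ∈ s \ R, x := by
    refine Finset.card_nsmul_le_sum _ _ _ fun x hx => ?_
    rw [Finset.mem_sdiff, hRmem] at hx
    have h0 : 0 ≤ x := by
      have := hx.1
      simp only [hs, Finset.mem_image, Finset.mem_univ, true_and] at this
      obtain ⟨i, rfl⟩ := this
      exact hα.1 i
    omega
  have h5 : ∑ x ∈ (R \ s).erase m, x ≤ ((R \ s).erase m).card • (N : ℤ) := by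
    refine Finset.sum_le_card_nsmul _ _ _ fun x hx => ?_
    have := (hRmem x).mp (Finset.mem_sdiff.mp (Finset.mem_of_mem_erase hx)).1
    omega
  have h6 := Finset.add_sum_erase (R \ s) (fun x : ℤ => x) hmR
  have h7 := Finset.card_erase_add_one hmR
  rw [← h3] at h7
  rw [nsmul_eq_mul] at h4 h5
  have h8 : ((s \ R).card : ℤ) * N = (((R \ s).erase m).card : ℤ) * N + N := by
    rw [← h7]
    push_cast
    ring
  omega

theorem lower_raise_sub_raise_lower {N : ℕ} {k l : ℤ} (hl : 0 ≤ l) (α : Fin N → ℤ) :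
    lower N k (raise N l (Finsupp.single α 1)) - raise N l (lower N k (Finsupp.single α 1))
      = ∑ i, if α i < k ∧ k ≤ α i + l then Finsupp.single (α + Pi.single i (l - k)) 1 else 0 := by
  have h1 : lower N k (raise N l (Finsupp.single α 1)) = ∑ i, ∑ j,
      if k ≤ (α + Pi.single j l : Fin N → ℤ) i then
        Finsupp.single (α + Pi.single j l + Pi.single i (-k)) (1 : ℂ) else 0 := by
    rw [raise_single, map_sum, Finset.sum_comm]
    exact Finset.sum_congr rfl fun j _ => lower_single _ _
  have h2 : raise N l (lower N k (Finsupp.single α 1)) = ∑ i, ∑ j,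
      if k ≤ α i then Finsupp.single (α + Pi.single i (-k) + Pi.single j l) (1 : ℂ) else 0 := by
    rw [lower_single, map_sum]
    refine Finset.sum_congr rfl fun i _ => ?_
    split_ifs with h
    · exact raise_single _ _
    · simp
  rw [h1, h2, ← Finset.sum_sub_distrib]
  refine Finset.sum_congr rfl fun i _ => ?_
  rw [← Finset.sum_sub_distrib, Finset.sum_eq_single i]
  · have e1 : α + Pi.single i l + Pi.single i (-k) = α + Pi.single i (l - k) := by
      rw [add_assoc, ← Pi.single_add, sub_eq_add_neg]
    have e2 : α + Pi.single i (-k) + Pi.single i l = α + Pi.single i (l - k) := by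
      rw [add_right_comm, e1]
    rw [e1, e2, Pi.add_apply, Pi.single_eq_same]
    by_cases c1 : k ≤ α i
    · have c2 : k ≤ α i + l := by omega
      simp [c1, c2]
    · by_cases c2 : k ≤ α i + l
      · simp [c1, c2, not_le.mp c1]
      · simp [c1, c2]
  · intro j _ hj
    rw [Pi.add_apply, Pi.single_eq_of_ne hj.symm, add_zero, add_right_comm, sub_self]
  · simp

/-- Shifting the exponents in turn, weighted by a function of the exponent, gives zero when two
exponents are equal: the two shifted alternants cancel. -/
theorem sum_alternant_add_single_of_not_injective {N : ℕ} {α : Fin N → ℤ}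
    (h : ¬ Function.Injective α) (m : ℤ) (p : ℤ → Prop) [DecidablePred p] (θ : Fin N → Torus) :
    ∑ i, (if p (α i) then alternant (α + Pi.single i m) θ else 0) = 0 := by
  simp only [Function.Injective, not_forall] at h
  obtain ⟨a, b, hab, hne⟩ := h
  have hα : α ∘ Equiv.swap a b = α := by
    ext x
    by_cases hxa : x = a
    · subst hxa
      simp [hab]
    by_cases hxb : x = b
    · subst hxb
      simp [hab]
    simp [Equiv.swap_apply_of_ne_of_ne hxa hxb]
  have hanti (i : Fin N) :
      (if p (α (Equiv.swap a b i)) then alternant (α + Pi.single (Equiv.swap a b i) m) θ else 0)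
        = - if p (α i) then alternant (α + Pi.single i m) θ else 0 := by
    have h1 : α + Pi.single (Equiv.swap a b i) m = (α + Pi.single i m) ∘ Equiv.swap a b := by
      ext x
      have h2 : α (Equiv.swap a b x) = α x := congrFun hα x
      by_cases hx : x = Equiv.swap a b i
      · subst hx
        simp [← h2]
      · have hx2 : Equiv.swap a b x ≠ i := by
          rintro rfl
          simp at hx
        simp [Pi.single_eq_of_ne hx, Pi.single_eq_of_ne hx2, h2]
    rw [h1, alternant_comp_perm, Equiv.Perm.sign_swap hne,
      show α (Equiv.swap a b i) = α i from congrFun hα i]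
    split_ifs <;> simp
  have h2 := Equiv.sum_comp (Equiv.swap a b)
    (fun i => if p (α i) then alternant (α + Pi.single i m) θ else 0)
  simp only [hanti, Finset.sum_neg_distrib] at h2
  exact self_eq_neg.mp h2.symm

/-- The canonical commutation relation `[T_k^*, T_l] = k δ_{kl}`, valid in degrees small compared
to the number of eigenvalues. -/
theorem alternantSum_commutator_single {N d k l : ℕ} (hkN : d + k ≤ N)
    (hlN : d + l ≤ N) {α : Fin N → ℤ} (hα : α ∈ level N d) (θ : Fin N → Torus) :
    alternantSum N (lower N k (raise N l (Finsupp.single α 1))) θ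
      = powerSum l θ * alternantSum N (lower N k (Finsupp.single α 1)) θ
        + (if k = l then (k : ℂ) else 0) * alternant α θ := by
  rw [← alternantSum_raise, ← sub_eq_iff_eq_add', ← Pi.sub_apply, ← map_sub,
    lower_raise_sub_raise_lower (by positivity), map_sum, Finset.sum_apply]
  have h1 (i : Fin N) : alternantSum N (if α i < k ∧ (k : ℤ) ≤ α i + l then
        Finsupp.single (α + Pi.single i ((l : ℤ) - k)) 1 else 0) θ
      = if α i < k ∧ (k : ℤ) ≤ α i + l then alternant (α + Pi.single i ((l : ℤ) - k)) θ else 0 := by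
    split_ifs
    · exact alternantSum_single _ _
    · simp
  simp only [h1]
  by_cases hinj : Function.Injective α
  · by_cases hkl : k = l
    · subst hkl
      simp only [sub_self, Pi.single_zero, add_zero, if_true]
      rw [← Finset.sum_filter, Finset.sum_const, nsmul_eq_mul]
      congr 2
      have himg : (Finset.univ.filter fun i => α i < k ∧ (k : ℤ) ≤ α i + k).image α
          = Finset.Ico (0 : ℤ) k := by
        ext x
        simp only [Finset.mem_image, Finset.mem_filter, Finset.mem_univ, true_and, Finset.mem_Ico]
        constructor
        · rintro ⟨i, hi, rfl⟩
          exact ⟨hα.1 i, hi.1⟩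
        · rintro ⟨hx0, hxk⟩
          obtain ⟨i, rfl⟩ := exists_eq_of_mem_level hα hinj hx0 (by omega)
          exact ⟨i, ⟨hxk, by omega⟩, rfl⟩
      rw [← Finset.card_image_of_injective _ hinj, himg]
      simp
    · rw [if_neg hkl, zero_mul]
      refine Finset.sum_eq_zero fun i _ => ?_
      split_ifs with hi
      · refine alternant_of_not_injective (fun hinj2 => ?_) θ
        -- The exponent `α i + l - k` lies in `[0, l)`, so that it is already occupied.
        obtain ⟨j, hj⟩ := exists_eq_of_mem_level hα hinj (m := α i + l - k) (by omega) (by omega)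
        have hji : j ≠ i := by
          rintro rfl
          omega
        refine hji (hinj2 ?_)
        rw [Pi.add_apply, Pi.add_apply, Pi.single_eq_same, Pi.single_eq_of_ne hji, hj]
        ring
      · rfl
  · rw [alternant_of_not_injective hinj, mul_zero]
    exact sum_alternant_add_single_of_not_injective hinj ((l : ℤ) - k)
      (fun x => x < k ∧ (k : ℤ) ≤ x + l) θ

theorem alternantSum_commutator {N d k l : ℕ} (hkN : d + k ≤ N)
    (hlN : d + l ≤ N) {v : (Fin N → ℤ) →₀ ℂ} (hv : v ∈ Finsupp.supported ℂ ℂ (level N d))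
    (θ : Fin N → Torus) :
    alternantSum N (lower N k (raise N l v)) θ
      = powerSum l θ * alternantSum N (lower N k v) θ
        + (if k = l then (k : ℂ) else 0) * alternantSum N v θ := by
  have h : Finsupp.supported ℂ ℂ (level N d) ≤ LinearMap.eqLocus
      (LinearMap.proj θ ∘ₗ alternantSum N ∘ₗ lower N k ∘ₗ raise N l :
        ((Fin N → ℤ) →₀ ℂ) →ₗ[ℂ] ℂ)
      (powerSum l θ • (LinearMap.proj θ ∘ₗ alternantSum N ∘ₗ lower N k) +
        (if k = l then (k : ℂ) else 0) • (LinearMap.proj θ ∘ₗ alternantSum N)) := by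
    rw [Finsupp.supported_eq_span_single, Submodule.span_le]
    rintro _ ⟨α, hα, rfl⟩
    simp only [SetLike.mem_coe, LinearMap.mem_eqLocus, LinearMap.comp_apply, LinearMap.add_apply,
      LinearMap.smul_apply, LinearMap.proj_apply, smul_eq_mul, alternantSum_single]
    exact alternantSum_commutator_single hkN hlN hα θ
  exact h hv

/-- The formal combination of exponents that represents `∏_{k ∈ μ} T_k` times the Vandermonde
determinant. -/
def excited (N : ℕ) (μ : List ℕ) : (Fin N → ℤ) →₀ ℂ :=
  μ.foldr (fun (l : ℕ) v => raise N (l : ℤ) v) (Finsupp.single (vacuum N) 1)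

theorem excited_cons {N : ℕ} (k : ℕ) (μ : List ℕ) :
    excited N (k :: μ) = raise N k (excited N μ) := rfl

theorem excited_mem {N : ℕ} (μ : List ℕ) :
    excited N μ ∈ Finsupp.supported ℂ ℂ (level N μ.sum) := by
  induction μ with
  | nil => exact Finsupp.single_mem_supported ℂ _ ⟨fun i => by simp [vacuum], by simp⟩
  | cons k μ ih =>
    rw [excited_cons, List.sum_cons]
    exact raise_mem ih

theorem alternantSum_excited {N : ℕ} (μ : List ℕ) (θ : Fin N → Torus) :
    alternantSum N (excited N μ) θ
      = (μ.map fun k : ℕ => powerSum (k : ℤ) θ).prod * alternant (vacuum N) θ := by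
  induction μ with
  | nil => simp [excited, alternantSum_single]
  | cons k μ ih =>
    rw [excited_cons, alternantSum_raise, ih, List.map_cons, List.prod_cons, mul_assoc]

theorem lower_vacuum {N k : ℕ} (hk : 0 < k) (θ : Fin N → Torus) :
    alternantSum N (lower N k (Finsupp.single (vacuum N) 1)) θ = 0 := by
  rw [lower_single, map_sum, Finset.sum_apply]
  refine Finset.sum_eq_zero fun i _ => ?_
  split_ifs with h
  · rw [alternantSum_single]
    refine alternant_of_not_injective (fun hinj => ?_) θ
    simp only [vacuum] at h
    have hne : (⟨(i : ℕ) - k, by omega⟩ : Fin N) ≠ i := by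
      intro he
      have := congrArg Fin.val he
      simp only at this
      omega
    refine hne (hinj ?_)
    rw [Pi.add_apply, Pi.add_apply, Pi.single_eq_same, Pi.single_eq_of_ne hne]
    simp only [vacuum]
    omega
  · simp

/-- On a product of traces times the Vandermonde determinant, `T_k T_k^*` is multiplication by `k`
times the number of factors `T_k`. -/
theorem powerSum_mul_lower_excited {N k : ℕ} (hk : 0 < k) (μ : List ℕ) (hμ : μ.sum + k ≤ N)
    (θ : Fin N → Torus) :
    powerSum k θ * alternantSum N (lower N k (excited N μ)) θ
      = k * (μ.count k : ℂ) * alternantSum N (excited N μ) θ := by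
  induction μ with
  | nil => simp [excited, lower_vacuum hk]
  | cons l μ ih =>
    rw [List.sum_cons] at hμ
    rw [excited_cons, alternantSum_commutator (d := μ.sum) (by omega) (by omega) (excited_mem μ),
      mul_add, mul_left_comm, ih (by omega), alternantSum_raise]
    by_cases hkl : k = l
    · subst hkl
      rw [List.count_cons_self, if_pos rfl]
      push_cast
      ring
    · rw [List.count_cons_of_ne (Ne.symm hkl), if_neg hkl]
      ring

theorem lower_excited_cons {N k : ℕ} (hk : 0 < k) (μ : List ℕ) (hμ : k + μ.sum ≤ N)
    (θ : Fin N → Torus) :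
    alternantSum N (lower N k (excited N (k :: μ))) θ
      = k * (μ.count k + 1 : ℂ) * alternantSum N (excited N μ) θ := by
  rw [excited_cons, alternantSum_commutator (d := μ.sum) (by omega) (by omega) (excited_mem μ),
    powerSum_mul_lower_excited hk μ (by omega), if_pos rfl]
  ring

theorem integral_norm_sq_excited {N : ℕ} (μ : List ℕ) (hpos : ∀ k ∈ μ, 0 < k) (hμ : μ.sum ≤ N)
    (s : Finset ℕ) (hs : ∀ k ∈ μ, k ∈ s) :
    ∫ θ, conj (alternantSum N (excited N μ) θ) * alternantSum N (excited N μ) θ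
      = (cueZ N : ℂ) * ∏ k ∈ s, ((k : ℂ) ^ μ.count k * ((μ.count k).factorial : ℂ)) := by
  induction μ with
  | nil =>
    simp only [excited, List.foldr_nil, alternantSum_single]
    rw [integral_norm_sq_alternant (vacuum_injective N)]
    simp
  | cons k μ ih =>
    rw [List.sum_cons] at hμ
    have hk : 0 < k := hpos k (by simp)
    have h1 (θ : Fin N → Torus) :
        conj (alternantSum N (excited N (k :: μ)) θ) * alternantSum N (excited N (k :: μ)) θ
          = conj (alternantSum N (excited N μ) θ) *
            (powerSum (-(k : ℤ)) θ * alternantSum N (excited N (k :: μ)) θ) := by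
      rw [← conj_powerSum]
      conv_lhs =>
        enter [1]
        rw [excited_cons, alternantSum_raise, map_mul]
      ring
    simp only [h1]
    rw [integral_conj_mul_powerSum_neg _ (excited_mem μ)]
    simp only [lower_excited_cons hk μ hμ]
    have h2 (θ : Fin N → Torus) : conj (alternantSum N (excited N μ) θ) *
          (k * (μ.count k + 1 : ℂ) * alternantSum N (excited N μ) θ)
        = k * (μ.count k + 1 : ℂ) *
          (conj (alternantSum N (excited N μ) θ) * alternantSum N (excited N μ) θ) := by ring
    simp only [h2]
    rw [integral_const_mul, ih (fun j hj => hpos j (by simp [hj])) (by omega)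
      (fun j hj => hs j (by simp [hj])), ← Finset.mul_prod_erase s _ (hs k (by simp)),
      ← Finset.mul_prod_erase s _ (hs k (by simp)), List.count_cons_self, Nat.factorial_succ]
    have h3 : ∏ j ∈ s.erase k, ((j : ℂ) ^ (k :: μ).count j * (((k :: μ).count j).factorial : ℂ))
        = ∏ j ∈ s.erase k, ((j : ℂ) ^ μ.count j * ((μ.count j).factorial : ℂ)) := by
      refine Finset.prod_congr rfl fun j hj => ?_
      rw [List.count_cons_of_ne (Finset.ne_of_mem_erase hj).symm]
    rw [h3]
    push_cast
    ring

/-- Up to total degree `N`, the `|T_k|²` have the joint moments of independent exponential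
variables with means `k`. -/
theorem integral_prod_norm_sq_powerSum_pow {N : ℕ} (a : ℕ →₀ ℕ) (h0 : ∀ k ∈ a.support, 0 < k)
    (ha : a.sum (fun k n => n * k) ≤ N) :
    ∫ θ, ∏ k ∈ a.support, (‖powerSum (k : ℤ) θ‖ ^ 2) ^ a k ∂(cueMeasure N)
      = ∏ k ∈ a.support, ((k : ℝ) ^ a k * ((a k).factorial : ℝ)) := by
  set μ : List ℕ := (Finsupp.toMultiset a).toList with hμ
  have hcount (k : ℕ) : μ.count k = a k := by
    rw [← Multiset.coe_count, hμ, Multiset.coe_toList, Finsupp.count_toMultiset]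
  have hmem (k : ℕ) : k ∈ μ ↔ k ∈ a.support := by
    rw [hμ, Multiset.mem_toList, Finsupp.mem_toMultiset]
  have hsum : μ.sum ≤ N := by
    have : μ.sum = a.sum fun k n => n * k := by
      rw [hμ, Multiset.sum_toList, Finsupp.toMultiset_apply, Finsupp.sum, Finsupp.sum,
        Multiset.sum_sum]
      exact Finset.sum_congr rfl fun k _ => by simp [Multiset.sum_nsmul]
    omega
  have h1 := integral_norm_sq_excited (N := N) μ (fun k hk => h0 k ((hmem k).mp hk)) hsum a.support
    fun k hk => (hmem k).mp hk
  simp only [hcount] at h1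
  have h2 (θ : Fin N → Torus) :
      conj (alternantSum N (excited N μ) θ) * alternantSum N (excited N μ) θ
        = ((cueWeight N θ • ∏ k ∈ a.support, (‖powerSum (k : ℤ) θ‖ ^ 2) ^ a k : ℝ) : ℂ) := by
    have h3 : (μ.map fun k : ℕ => powerSum (k : ℤ) θ).prod
        = ∏ k ∈ a.support, powerSum (k : ℤ) θ ^ a k := by
      rw [Finset.prod_list_map_count]
      refine Finset.prod_congr ?_ fun k _ => by rw [hcount]
      ext k
      rw [List.mem_toFinset, hmem]
    rw [alternantSum_excited, h3, Complex.conj_mul', norm_mul, norm_prod, smul_eq_mul,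
      cueWeight_eq_norm_sq]
    simp only [norm_pow]
    push_cast
    rw [mul_pow, mul_comm, ← Finset.prod_pow]
    congr 1
    refine Finset.prod_congr rfl fun k _ => by ring
  simp only [h2] at h1
  rw [integral_complex_ofReal] at h1
  rw [integral_cueMeasure, smul_eq_mul, inv_mul_eq_iff_eq_mul₀ (cueZ_pos N).ne']
  exact_mod_cast h1

/-! ### Sums of independent exponential variables -/

theorem expMeasure_one_eq :
    expMeasure 1 = (volume.restrict (Set.Ioi (0 : ℝ))).withDensity
      fun x => ENNReal.ofReal (Real.exp (-x)) := by
  have h : expMeasure 1 = volume.withDensity (exponentialPDF 1) := rfl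
  rw [h, ← withDensity_indicator measurableSet_Ioi]
  refine withDensity_congr_ae ?_
  have h0 : ∀ᵐ x : ℝ, x ≠ 0 := by
    simp [ae_iff]
  filter_upwards [h0] with x hx
  rw [exponentialPDF_eq]
  rcases lt_or_gt_of_ne hx with hlt | hgt
  · rw [if_neg (not_le.mpr hlt), Set.indicator_of_notMem (by simpa using hlt.le),
      ENNReal.ofReal_zero]
  · rw [if_pos hgt.le, Set.indicator_of_mem (Set.mem_Ioi.mpr hgt)]
    simp

instance : IsProbabilityMeasure (expMeasure 1) := isProbabilityMeasure_expMeasure one_pos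

theorem integral_expMeasure_one {E : Type*} [NormedAddCommGroup E] [NormedSpace ℝ E]
    (g : ℝ → E) : ∫ x, g x ∂(expMeasure 1) = ∫ x in Set.Ioi (0 : ℝ), Real.exp (-x) • g x := by
  rw [expMeasure_one_eq, integral_withDensity_eq_integral_toReal_smul]
  · refine integral_congr_ae (ae_of_all _ fun x => ?_)
    simp only
    rw [ENNReal.toReal_ofReal (Real.exp_pos _).le]
  · exact (Real.continuous_exp.comp continuous_neg).measurable.ennreal_ofReal
  · exact ae_of_all _ fun x => ENNReal.ofReal_lt_top

theorem integrable_expMeasure_one_iff {E : Type*} [NormedAddCommGroup E] [NormedSpace ℝ E]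
    (g : ℝ → E) : Integrable g (expMeasure 1) ↔
      IntegrableOn (fun x => Real.exp (-x) • g x) (Set.Ioi (0 : ℝ)) := by
  rw [expMeasure_one_eq, integrable_withDensity_iff_integrable_smul']
  · refine integrable_congr (ae_of_all _ fun x => ?_)
    simp only
    rw [ENNReal.toReal_ofReal (Real.exp_pos _).le]
  · exact (Real.continuous_exp.comp continuous_neg).measurable.ennreal_ofReal
  · exact ae_of_all _ fun x => ENNReal.ofReal_lt_top

theorem integral_pow_expMeasure_one (n : ℕ) :
    ∫ x, x ^ n ∂(expMeasure 1) = (n.factorial : ℝ) := by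
  rw [integral_expMeasure_one, ← Real.Gamma_nat_eq_factorial,
    Real.Gamma_eq_integral (by positivity)]
  simp

theorem integrable_pow_expMeasure_one (n : ℕ) :
    Integrable (fun x : ℝ => x ^ n) (expMeasure 1) := by
  rw [integrable_expMeasure_one_iff]
  have h := Real.GammaIntegral_convergent (s := (n : ℝ) + 1) (by positivity)
  simpa using h

theorem exp_mul_cexp_eq (z : ℂ) (x : ℝ) :
    Real.exp (-x) • Complex.exp (z * ((x : ℂ) - 1))
      = Complex.exp (-z) * Complex.exp ((z - 1) * x) := by
  rw [Complex.real_smul, Complex.ofReal_exp, ← Complex.exp_add, ← Complex.exp_add]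
  congr 1
  push_cast
  ring

theorem integrable_cexp_expMeasure_one {z : ℂ} (hz : z.re < 1) :
    Integrable (fun x : ℝ => Complex.exp (z * ((x : ℂ) - 1))) (expMeasure 1) := by
  rw [integrable_expMeasure_one_iff]
  simp only [exp_mul_cexp_eq]
  exact (integrableOn_exp_mul_complex_Ioi (by simpa using hz) 0).const_mul _

/-- The complex moment generating function of a centred exponential variable. -/
theorem integral_cexp_expMeasure_one {z : ℂ} (hz : z.re < 1) :
    ∫ x : ℝ, Complex.exp (z * ((x : ℂ) - 1)) ∂(expMeasure 1) = Complex.exp (-z) / (1 - z) := by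
  rw [integral_expMeasure_one]
  simp only [exp_mul_cexp_eq]
  rw [integral_const_mul, integral_exp_mul_complex_Ioi (by simpa using hz)]
  rw [← neg_sub 1 z, Complex.ofReal_zero, mul_zero, Complex.exp_zero, neg_div_neg_eq, mul_one_div]

/-- `K` independent exponential variables of mean `1`. -/
abbrev expProduct (K : ℕ) : Measure (Fin K → ℝ) := Measure.pi fun _ => expMeasure 1

theorem integral_monomial_expProduct {K : ℕ} (a : Fin K → ℕ) :
    ∫ x, ∏ i, x i ^ a i ∂(expProduct K) = ∏ i, ((a i).factorial : ℝ) := by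
  rw [integral_fintype_prod_eq_prod (f := fun i (x : ℝ) => x ^ a i)]
  simp only [integral_pow_expMeasure_one]

theorem integrable_monomial_expProduct {K : ℕ} (a : Fin K → ℕ) :
    Integrable (fun x : Fin K → ℝ => ∏ i, x i ^ a i) (expProduct K) :=
  Integrable.fintype_prod (f := fun i (x : ℝ) => x ^ a i) fun _ => integrable_pow_expMeasure_one _

/-- The centred linear combination `∑ b_i (x_i - 1)`. -/
def centredSum {K : ℕ} (b : Fin K → ℝ) (x : Fin K → ℝ) : ℝ := ∑ i, b i * (x i - 1)

theorem cexp_mul_centredSum {K : ℕ} (b : Fin K → ℝ) (z : ℂ) (x : Fin K → ℝ) :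
    Complex.exp (z * (centredSum b x : ℂ)) = ∏ i, Complex.exp (z * b i * ((x i : ℂ) - 1)) := by
  rw [← Complex.exp_sum, centredSum]
  push_cast
  rw [Finset.mul_sum]
  simp only [mul_assoc]

theorem integral_cexp_centredSum {K : ℕ} (b : Fin K → ℝ) {z : ℂ} (hz : ∀ i, (z * b i).re < 1) :
    ∫ x, Complex.exp (z * (centredSum b x : ℂ)) ∂(expProduct K)
      = ∏ i, (Complex.exp (-(z * b i)) / (1 - z * b i)) := by
  simp only [cexp_mul_centredSum]
  rw [integral_fintype_prod_eq_prod (f := fun i (x : ℝ) => Complex.exp (z * b i * ((x : ℂ) - 1)))]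
  exact Finset.prod_congr rfl fun i _ => integral_cexp_expMeasure_one (hz i)

theorem integrable_cexp_centredSum {K : ℕ} (b : Fin K → ℝ) {z : ℂ} (hz : ∀ i, (z * b i).re < 1) :
    Integrable (fun x => Complex.exp (z * (centredSum b x : ℂ))) (expProduct K) := by
  simp only [cexp_mul_centredSum]
  exact Integrable.fintype_prod (f := fun i (x : ℝ) => Complex.exp (z * b i * ((x : ℂ) - 1)))
    fun i => integrable_cexp_expMeasure_one (hz i)

/-- A centred exponential variable is approximately Gaussian on the logarithmic scale. -/
theorem exists_exp_div_one_sub_eq {z : ℂ} (hz : ‖z‖ ≤ 1 / 2) :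
    ∃ e : ℂ, ‖e‖ ≤ ‖z‖ ^ 3 ∧ Complex.exp (-z) / (1 - z) = Complex.exp (z ^ 2 / 2 + e) := by
  have h1 : ‖z‖ < 1 := by linarith
  have h2 := Complex.norm_log_one_sub_inv_add_logTaylor_neg_le 2 h1
  have h3 : Complex.logTaylor (2 + 1) (-z) = -z - z ^ 2 / 2 := by
    simp [Complex.logTaylor_succ, Complex.logTaylor_zero]
    ring
  rw [h3] at h2
  refine ⟨Complex.log (1 - z)⁻¹ + (-z - z ^ 2 / 2), h2.trans ?_, ?_⟩
  · have h4 : (1 - ‖z‖)⁻¹ ≤ 2 := by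
      rw [inv_le_comm₀ (by linarith) (by norm_num)]
      linarith
    have h5 := mul_le_mul_of_nonneg_left h4 (pow_nonneg (norm_nonneg z) 3)
    norm_num at h5 ⊢
    have h6 := pow_nonneg (norm_nonneg z) 3
    linarith
  · have hne : 1 - z ≠ 0 := by
      intro h
      have : z = 1 := (sub_eq_zero.mp h).symm
      rw [this] at h1
      simp at h1
    rw [show z ^ 2 / 2 + (Complex.log (1 - z)⁻¹ + (-z - z ^ 2 / 2))
      = -z + Complex.log (1 - z)⁻¹ by ring, Complex.exp_add, Complex.exp_log (inv_ne_zero hne),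
      div_eq_mul_inv]

theorem exists_integral_cexp_centredSum_eq {K : ℕ} (b : Fin K → ℝ) {z : ℂ}
    (hz : ∀ i, ‖z * b i‖ ≤ 1 / 2) :
    ∃ e : ℂ, ‖e‖ ≤ ∑ i, ‖z * b i‖ ^ 3 ∧
      ∫ x, Complex.exp (z * (centredSum b x : ℂ)) ∂(expProduct K)
        = Complex.exp (z ^ 2 * (∑ i, b i ^ 2 : ℝ) / 2 + e) := by
  choose e he he2 using fun i => exists_exp_div_one_sub_eq (hz i)
  refine ⟨∑ i, e i, (norm_sum_le _ _).trans (Finset.sum_le_sum fun i _ => he i), ?_⟩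
  rw [integral_cexp_centredSum b fun i =>
    ((Complex.re_le_norm _).trans (hz i)).trans_lt (by norm_num)]
  simp only [he2]
  rw [← Complex.exp_sum, Finset.sum_add_distrib]
  congr 2
  push_cast
  rw [Finset.mul_sum, Finset.sum_div]
  exact Finset.sum_congr rfl fun i _ => by ring

theorem integrable_exp_centredSum {K : ℕ} (b : Fin K → ℝ) {s : ℝ} (hs : ∀ i, |s * b i| ≤ 1 / 2) :
    Integrable (fun x => Real.exp (s * centredSum b x)) (expProduct K) := by
  have h := (integrable_cexp_centredSum b (z := (s : ℂ)) fun i => by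
    rw [← Complex.ofReal_mul, Complex.ofReal_re]
    exact ((le_abs_self _).trans (hs i)).trans_lt (by norm_num)).re
  refine h.congr (ae_of_all _ fun x => ?_)
  simp only [RCLike.re_eq_complex_re]
  rw [← Complex.ofReal_mul, ← Complex.ofReal_exp, Complex.ofReal_re]

theorem integral_exp_centredSum_le {K : ℕ} (b : Fin K → ℝ) {s : ℝ} (hs : ∀ i, |s * b i| ≤ 1 / 2) :
    ∫ x, Real.exp (s * centredSum b x) ∂(expProduct K) ≤ Real.exp (s ^ 2 * ∑ i, b i ^ 2) := by
  have hn (i : Fin K) : ‖(s : ℂ) * b i‖ = |s * b i| := by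
    rw [← Complex.ofReal_mul, Complex.norm_real, Real.norm_eq_abs]
  obtain ⟨e, he, h⟩ := exists_integral_cexp_centredSum_eq b (z := (s : ℂ)) fun i => by
    rw [hn]
    exact hs i
  have h1 : ((∫ x, Real.exp (s * centredSum b x) ∂(expProduct K) : ℝ) : ℂ)
      = Complex.exp ((s : ℂ) ^ 2 * (∑ i, b i ^ 2 : ℝ) / 2 + e) := by
    rw [← h, ← integral_complex_ofReal]
    simp
  have h2 : ∫ x, Real.exp (s * centredSum b x) ∂(expProduct K)
      ≤ ‖Complex.exp ((s : ℂ) ^ 2 * (∑ i, b i ^ 2 : ℝ) / 2 + e)‖ := by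
    rw [← h1, Complex.norm_real]
    exact Real.le_norm_self _
  refine h2.trans ?_
  rw [Complex.norm_exp]
  apply Real.exp_le_exp.mpr
  have h3 : ((s : ℂ) ^ 2 * (∑ i, b i ^ 2 : ℝ) / 2 + e).re = s ^ 2 * (∑ i, b i ^ 2) / 2 + e.re := by
    have : ((s : ℂ) ^ 2 * (∑ i, b i ^ 2 : ℝ) / 2) = ((s ^ 2 * (∑ i, b i ^ 2) / 2 : ℝ) : ℂ) := by
      push_cast
      ring
    rw [Complex.add_re, this, Complex.ofReal_re]
  rw [h3]
  have h4 : ∑ i, ‖(s : ℂ) * b i‖ ^ 3 ≤ s ^ 2 * (∑ i, b i ^ 2) / 2 := by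
    rw [Finset.mul_sum, Finset.sum_div]
    refine Finset.sum_le_sum fun i _ => ?_
    rw [hn, pow_succ, sq_abs, mul_pow, div_eq_mul_one_div]
    exact mul_le_mul_of_nonneg_left (hs i) (by positivity)
  have h5 := (Complex.re_le_norm e).trans (he.trans h4)
  linarith

/-- The characteristic function of a sum of independent centred exponential variables with small
coefficients is close to that of a Gaussian variable of the same variance. -/
theorem norm_charFun_centredSum_sub_le {K : ℕ} (b : Fin K → ℝ) {t β : ℝ}
    (hβ : ∀ i, |b i| ≤ β) (ht : |t| * β ≤ 1 / 2) (hsmall : |t| ^ 3 * β * ∑ i, b i ^ 2 ≤ 1) :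
    ‖∫ x, Complex.exp (t * Complex.I * (centredSum b x : ℂ)) ∂(expProduct K)
        - Complex.exp ((-(t ^ 2 * (∑ i, b i ^ 2) / 2) : ℝ) : ℂ)‖
      ≤ 2 * (|t| ^ 3 * β * ∑ i, b i ^ 2) := by
  have hn (i : Fin K) : ‖(t : ℂ) * Complex.I * b i‖ = |t| * |b i| := by
    simp
  obtain ⟨e, he, h⟩ := exists_integral_cexp_centredSum_eq b (z := (t : ℂ) * Complex.I) fun i => by
    rw [hn]
    exact (mul_le_mul_of_nonneg_left (hβ i) (abs_nonneg t)).trans ht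
  have he2 : ‖e‖ ≤ |t| ^ 3 * β * ∑ i, b i ^ 2 := by
    refine he.trans ?_
    rw [Finset.mul_sum]
    refine Finset.sum_le_sum fun i _ => ?_
    rw [hn, mul_pow, mul_assoc, ← sq_abs (b i), pow_succ' |b i|]
    gcongr
    exact hβ i
  have harg : ((t : ℂ) * Complex.I) ^ 2 * (∑ i, b i ^ 2 : ℝ) / 2 + e
      = ((-(t ^ 2 * (∑ i, b i ^ 2) / 2) : ℝ) : ℂ) + e := by
    rw [mul_pow, Complex.I_sq]
    push_cast
    ring
  rw [h, harg, Complex.exp_add, ← mul_sub_one, norm_mul, ← Complex.ofReal_exp, Complex.norm_real,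
    Real.norm_eq_abs, Real.abs_exp]
  have h1 : Real.exp (-(t ^ 2 * (∑ i, b i ^ 2) / 2)) ≤ 1 := by
    rw [Real.exp_le_one_iff]
    have : 0 ≤ t ^ 2 * (∑ i, b i ^ 2) / 2 := by positivity
    linarith
  calc Real.exp (-(t ^ 2 * (∑ i, b i ^ 2) / 2)) * ‖Complex.exp e - 1‖
      ≤ 1 * (2 * ‖e‖) := by
        gcongr
        exact Complex.norm_exp_sub_one_le (he2.trans hsmall)
    _ ≤ _ := by linarith

/-! ### Comparing characteristic functions through moments -/

/-- The Taylor remainder of `e^{ix}`, uniformly in `x`. -/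
theorem norm_exp_mul_I_sub_sum_le_of_nonneg (m : ℕ) {x : ℝ} (hx : 0 ≤ x) :
    ‖Complex.exp (x * Complex.I) - ∑ j ∈ Finset.range m, ((x : ℂ) * Complex.I) ^ j / j.factorial‖
      ≤ x ^ m / m.factorial := by
  induction m generalizing x with
  | zero => simp [Complex.norm_exp_ofReal_mul_I]
  | succ m ih =>
    set f : ℝ → ℂ := fun y => Complex.exp (y * Complex.I)
      - ∑ j ∈ Finset.range (m + 1), ((y : ℂ) * Complex.I) ^ j / j.factorial with hf
    set f' : ℝ → ℂ := fun y => Complex.I * (Complex.exp (y * Complex.I)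
      - ∑ j ∈ Finset.range m, ((y : ℂ) * Complex.I) ^ j / j.factorial) with hf'
    have hd (y : ℝ) : HasDerivAt f (f' y) y := by
      have hI : HasDerivAt (fun y : ℝ => (y : ℂ) * Complex.I) Complex.I y := by
        simpa using (Complex.ofRealCLM.hasDerivAt (x := y)).mul_const Complex.I
      have h1 := hI.cexp
      have h2 : HasDerivAt (fun y : ℝ => ∑ j ∈ Finset.range (m + 1),
          ((y : ℂ) * Complex.I) ^ j / j.factorial)
          (∑ j ∈ Finset.range m, ((y : ℂ) * Complex.I) ^ j / j.factorial * Complex.I) y := by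
        simp only [Finset.sum_range_succ' _ m, pow_zero]
        have h3 (j : ℕ) (_ : j ∈ Finset.range m) : HasDerivAt
            (fun y : ℝ => ((y : ℂ) * Complex.I) ^ (j + 1) / (j + 1).factorial)
            (((y : ℂ) * Complex.I) ^ j / j.factorial * Complex.I) y := by
          refine ((hI.fun_pow (j + 1)).div_const (((j + 1).factorial : ℕ) : ℂ)).congr_deriv ?_
          rw [Nat.factorial_succ]
          have : (j.factorial : ℂ) ≠ 0 := by exact_mod_cast j.factorial_ne_zero
          have : (j + 1 : ℂ) ≠ 0 := by exact_mod_cast j.succ_ne_zero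
          push_cast
          field_simp
        exact (HasDerivAt.fun_sum h3).add_const _
      refine (h1.fun_sub h2).congr_deriv ?_
      rw [hf', ← Finset.sum_mul]
      ring
    have hB (y : ℝ) : HasDerivAt (fun y : ℝ => y ^ (m + 1) / (m + 1).factorial)
        (y ^ m / m.factorial) y := by
      refine ((hasDerivAt_pow (m + 1) y).div_const (((m + 1).factorial : ℕ) : ℝ)).congr_deriv ?_
      rw [Nat.factorial_succ]
      have : (m.factorial : ℝ) ≠ 0 := by exact_mod_cast m.factorial_ne_zero
      have : (m + 1 : ℝ) ≠ 0 := by exact_mod_cast m.succ_ne_zero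
      push_cast
      field_simp
    refine image_norm_le_of_norm_deriv_right_le_deriv_boundary (a := 0) (b := x) (f := f) (f' := f')
      (fun y _ => (hd y).continuousAt.continuousWithinAt) (fun y _ => (hd y).hasDerivWithinAt)
      (B := fun y : ℝ => y ^ (m + 1) / (m + 1).factorial) (B' := fun y => y ^ m / m.factorial)
      ?_ hB (fun y hy => ?_) (Set.right_mem_Icc.mpr hx)
    · simp [hf, Finset.sum_range_succ']
    · rw [hf', norm_mul, Complex.norm_I, one_mul]
      exact ih hy.1

theorem norm_exp_mul_I_sub_sum_le (m : ℕ) (x : ℝ) :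
    ‖Complex.exp (x * Complex.I) - ∑ j ∈ Finset.range m, ((x : ℂ) * Complex.I) ^ j / j.factorial‖
      ≤ |x| ^ m / m.factorial := by
  rcases le_total 0 x with hx | hx
  · rw [abs_of_nonneg hx]
    exact norm_exp_mul_I_sub_sum_le_of_nonneg m hx
  · rw [abs_of_nonpos hx]
    refine le_trans (le_of_eq ?_) (norm_exp_mul_I_sub_sum_le_of_nonneg m (neg_nonneg.mpr hx))
    rw [← Complex.norm_conj]
    congr 1
    simp [← Complex.exp_conj, map_sum]

theorem norm_integral_cexp_sub_sum_le {Ω : Type*} [MeasurableSpace Ω] {μ : Measure Ω}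
    [IsProbabilityMeasure μ] {X : Ω → ℝ} (hX : AEMeasurable X μ) (t : ℝ) {m : ℕ} (hm : Even m)
    (hint : ∀ j ≤ m, Integrable (fun ω => X ω ^ j) μ) :
    ‖∫ ω, Complex.exp (t * Complex.I * (X ω : ℂ)) ∂μ
        - ∑ j ∈ Finset.range m, (t * Complex.I) ^ j / j.factorial * ((∫ ω, X ω ^ j ∂μ : ℝ) : ℂ)‖
      ≤ |t| ^ m * (∫ ω, X ω ^ m ∂μ) / m.factorial := by
  have hexp : Integrable (fun ω => Complex.exp (t * Complex.I * (X ω : ℂ))) μ := by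
    refine Integrable.of_bound (C := 1) ?_ (ae_of_all _ fun ω => ?_)
    · exact (Complex.measurable_exp.comp_aemeasurable
        ((Complex.measurable_ofReal.comp_aemeasurable hX).const_mul _)).aestronglyMeasurable
    · rw [show (t : ℂ) * Complex.I * (X ω : ℂ) = ((t * X ω : ℝ) : ℂ) * Complex.I by
        push_cast; ring, Complex.norm_exp_ofReal_mul_I]
  have hterm (j : ℕ) (hj : j ∈ Finset.range m) :
      Integrable (fun ω => (t * Complex.I) ^ j / j.factorial * ((X ω ^ j : ℝ) : ℂ)) μ :=
    (hint j (Finset.mem_range.mp hj).le).ofReal.const_mul _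
  have h1 : ∑ j ∈ Finset.range m, (t * Complex.I) ^ j / j.factorial *
        ((∫ ω, X ω ^ j ∂μ : ℝ) : ℂ)
      = ∫ ω, ∑ j ∈ Finset.range m, (t * Complex.I) ^ j / j.factorial * ((X ω ^ j : ℝ) : ℂ) ∂μ := by
    rw [integral_finsetSum _ hterm]
    refine Finset.sum_congr rfl fun j _ => ?_
    rw [integral_const_mul, integral_complex_ofReal]
  rw [h1, ← integral_sub hexp (integrable_finsetSum _ hterm)]
  refine (norm_integral_le_of_norm_le (g := fun ω => |t| ^ m * X ω ^ m / m.factorial)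
    (((hint m le_rfl).const_mul _).div_const _) (ae_of_all _ fun ω => ?_)).trans (le_of_eq ?_)
  · have h2 := norm_exp_mul_I_sub_sum_le m (t * X ω)
    rw [abs_mul, mul_pow, hm.pow_abs (X ω)] at h2
    refine le_trans (le_of_eq ?_) h2
    congr 2
    · congr 1
      push_cast
      ring
    · refine Finset.sum_congr rfl fun j _ => ?_
      push_cast
      ring
  · rw [integral_div, integral_const_mul]

/-- Two variables with the same moments up to an even order `m` have nearly the same
characteristic function. -/
theorem norm_integral_cexp_sub_le {Ω Ω' : Type*} [MeasurableSpace Ω] [MeasurableSpace Ω']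
    {μ : Measure Ω} {ν : Measure Ω'} [IsProbabilityMeasure μ] [IsProbabilityMeasure ν]
    {X : Ω → ℝ} {Y : Ω' → ℝ} (hX : AEMeasurable X μ) (hY : AEMeasurable Y ν) (t : ℝ) {m : ℕ}
    (hm : Even m) (hintX : ∀ j ≤ m, Integrable (fun ω => X ω ^ j) μ)
    (hintY : ∀ j ≤ m, Integrable (fun ω => Y ω ^ j) ν)
    (heq : ∀ j ≤ m, ∫ ω, X ω ^ j ∂μ = ∫ ω, Y ω ^ j ∂ν) :
    ‖∫ ω, Complex.exp (t * Complex.I * (X ω : ℂ)) ∂μ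
        - ∫ ω, Complex.exp (t * Complex.I * (Y ω : ℂ)) ∂ν‖
      ≤ 2 * (|t| ^ m * (∫ ω, Y ω ^ m ∂ν) / m.factorial) := by
  have h1 := norm_integral_cexp_sub_sum_le hX t hm hintX
  have h2 := norm_integral_cexp_sub_sum_le hY t hm hintY
  rw [heq m le_rfl] at h1
  have h3 : ∑ j ∈ Finset.range m, ((t : ℂ) * Complex.I) ^ j / j.factorial *
        ((∫ ω, X ω ^ j ∂μ : ℝ) : ℂ)
      = ∑ j ∈ Finset.range m, (t * Complex.I) ^ j / j.factorial * ((∫ ω, Y ω ^ j ∂ν : ℝ) : ℂ) :=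
    Finset.sum_congr rfl fun j hj => by rw [heq j (Finset.mem_range.mp hj).le]
  rw [h3] at h1
  have h4 := norm_sub_le_norm_sub_add_norm_sub
    (∫ ω, Complex.exp (t * Complex.I * (X ω : ℂ)) ∂μ)
    (∑ j ∈ Finset.range m, (t * Complex.I) ^ j / j.factorial * ((∫ ω, Y ω ^ j ∂ν : ℝ) : ℂ))
    (∫ ω, Complex.exp (t * Complex.I * (Y ω : ℂ)) ∂ν)
  rw [norm_sub_rev (∑ j ∈ Finset.range m, _) (∫ ω, Complex.exp (t * Complex.I * (Y ω : ℂ)) ∂ν)]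
    at h4
  linarith

theorem pow_div_factorial_le_exp_add_exp (m : ℕ) (x : ℝ) :
    |x| ^ m / m.factorial ≤ Real.exp x + Real.exp (-x) := by
  refine (Real.pow_div_factorial_le_exp |x| (abs_nonneg x) m).trans ?_
  rcases abs_cases x with ⟨h, _⟩ | ⟨h, _⟩ <;> rw [h]
  · linarith [Real.exp_pos (-x)]
  · linarith [Real.exp_pos x]

theorem integral_pow_centredSum_le {K : ℕ} (b : Fin K → ℝ) {s : ℝ} (hs0 : 0 < s)
    (hs : ∀ i, |s * b i| ≤ 1 / 2) {m : ℕ} (hm : Even m)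
    (hint : Integrable (fun x => centredSum b x ^ m) (expProduct K)) :
    (∫ x, centredSum b x ^ m ∂(expProduct K)) / m.factorial
      ≤ 2 * Real.exp (s ^ 2 * ∑ i, b i ^ 2) / s ^ m := by
  have hs' (i : Fin K) : |(-s) * b i| ≤ 1 / 2 := by
    rw [neg_mul, abs_neg]
    exact hs i
  rw [le_div_iff₀ (by positivity)]
  have h1 : (∫ x, centredSum b x ^ m ∂(expProduct K)) / m.factorial * s ^ m
      = ∫ x, |s * centredSum b x| ^ m / m.factorial ∂(expProduct K) := by
    simp only [hm.pow_abs, mul_pow]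
    rw [integral_div, integral_const_mul]
    ring
  rw [h1]
  have h2 : ∫ x, |s * centredSum b x| ^ m / m.factorial ∂(expProduct K)
      ≤ ∫ x, (Real.exp (s * centredSum b x) + Real.exp (-s * centredSum b x)) ∂(expProduct K) := by
    refine integral_mono ?_ ((integrable_exp_centredSum b hs).add (integrable_exp_centredSum b hs'))
      fun x => ?_
    · simp only [hm.pow_abs, mul_pow]
      exact (hint.const_mul _).div_const _
    · rw [neg_mul]
      exact pow_div_factorial_le_exp_add_exp m _
  refine h2.trans ?_
  rw [integral_add (integrable_exp_centredSum b hs) (integrable_exp_centredSum b hs')]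
  have h3 := integral_exp_centredSum_le b hs
  have h4 := integral_exp_centredSum_le b hs'
  rw [neg_sq] at h4
  linarith

/-! ### Gaussian approximation for the low frequencies -/

/-- The normalised squared traces `|T_k|² / k` for `1 ≤ k ≤ K`. -/
def traceSq {N : ℕ} (K : ℕ) (θ : Fin N → Torus) (i : Fin K) : ℝ :=
  ‖powerSum (((i : ℕ) + 1 : ℕ) : ℤ) θ‖ ^ 2 / ((i : ℕ) + 1 : ℕ)

theorem continuous_traceSq {N K : ℕ} : Continuous (traceSq K : (Fin N → Torus) → Fin K → ℝ) :=
  continuous_pi fun _ => ((continuous_powerSum _).norm.pow 2).div_const _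

theorem integral_prod_traceSq_pow {N K : ℕ} (a : Fin K →₀ ℕ)
    (ha : ∑ i, a i * ((i : ℕ) + 1) ≤ N) :
    ∫ θ, ∏ i, traceSq K θ i ^ a i ∂(cueMeasure N) = ∏ i, ((a i).factorial : ℝ) := by
  set e : Fin K ↪ ℕ := ⟨fun i => (i : ℕ) + 1, fun i j h => Fin.ext (by simpa using h)⟩ with he
  have hsum {M : Type} [CommMonoid M] (g : Fin K → ℕ → M) (hg : ∀ i, g i 0 = 1) :
      ∏ i ∈ a.support, g i (a i) = ∏ i, g i (a i) := by
    refine Finset.prod_subset (Finset.subset_univ _) fun i _ hi => ?_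
    rw [Finsupp.notMem_support_iff.mp hi, hg]
  have h1 := integral_prod_norm_sq_powerSum_pow (N := N) (a.embDomain e) (fun k hk => by
    rw [Finsupp.support_embDomain, Finset.mem_map] at hk
    obtain ⟨i, _, rfl⟩ := hk
    exact Nat.succ_pos _) (by
    rw [Finsupp.sum, Finsupp.support_embDomain, Finset.sum_map]
    simp only [Finsupp.embDomain_apply_self]
    exact (Finset.sum_le_univ_sum_of_nonneg fun i => Nat.zero_le _).trans ha)
  simp only [Finsupp.support_embDomain, Finset.prod_map, Finsupp.embDomain_apply_self] at h1
  have h2 (θ : Fin N → Torus) := hsum (fun i n => (‖powerSum ((e i : ℕ) : ℤ) θ‖ ^ 2) ^ n)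
    fun i => pow_zero _
  simp only [h2] at h1
  rw [hsum (fun i n => (e i : ℝ) ^ n * (n.factorial : ℝ)) (by simp)] at h1
  have hne : ∏ i, (e i : ℝ) ^ a i ≠ 0 :=
    Finset.prod_ne_zero_iff.mpr fun i _ => pow_ne_zero _ (Nat.cast_ne_zero.mpr (Nat.succ_ne_zero _))
  have h3 (θ : Fin N → Torus) : ∏ i, traceSq K θ i ^ a i
      = (∏ i, (‖powerSum ((e i : ℕ) : ℤ) θ‖ ^ 2) ^ a i) / ∏ i, (e i : ℝ) ^ a i := by
    rw [← Finset.prod_div_distrib]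
    exact Finset.prod_congr rfl fun i _ => div_pow _ _ _
  simp only [h3]
  rw [integral_div, h1, Finset.prod_mul_distrib, mul_div_cancel_left₀ _ hne]

/-- In low degree, the `|T_k|² / k` have the same joint moments as independent exponential
variables. -/
theorem integral_eval_traceSq {N K m : ℕ} (hm : m * K ≤ N) (p : MvPolynomial (Fin K) ℝ)
    (hp : p.totalDegree ≤ m) :
    ∫ θ, MvPolynomial.eval (traceSq K θ) p ∂(cueMeasure N)
      = ∫ x, MvPolynomial.eval x p ∂(expProduct K) := by
  simp only [MvPolynomial.eval_eq']
  rw [integral_finsetSum, integral_finsetSum]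
  · refine Finset.sum_congr rfl fun d hd => ?_
    rw [integral_const_mul, integral_const_mul, integral_monomial_expProduct,
      integral_prod_traceSq_pow]
    have h1 : ∑ i, d i ≤ m := by
      refine le_trans (le_of_eq ?_) ((MvPolynomial.le_totalDegree hd).trans hp)
      rw [Finsupp.sum_fintype _ _ fun _ => rfl]
    calc ∑ i, d i * ((i : ℕ) + 1) ≤ ∑ i, d i * K :=
          Finset.sum_le_sum fun i _ => Nat.mul_le_mul_left _ i.isLt
      _ = (∑ i, d i) * K := by rw [Finset.sum_mul]
      _ ≤ m * K := Nat.mul_le_mul_right _ h1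
      _ ≤ N := hm
  · exact fun d _ => (integrable_monomial_expProduct _).const_mul _
  · exact fun d _ => (integrable_cueMeasure_of_continuous (continuous_finsetProd _ fun i _ =>
      ((continuous_apply i).comp continuous_traceSq).pow _)).const_mul _

theorem integrable_eval_expProduct {K : ℕ} (p : MvPolynomial (Fin K) ℝ) :
    Integrable (fun x => MvPolynomial.eval x p) (expProduct K) := by
  simp only [MvPolynomial.eval_eq']
  exact integrable_finsetSum _ fun d _ => (integrable_monomial_expProduct _).const_mul _

/-- `centredSum b` as a polynomial. -/
def centredPoly {K : ℕ} (b : Fin K → ℝ) : MvPolynomial (Fin K) ℝ :=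
  ∑ i, MvPolynomial.C (b i) * (MvPolynomial.X i - 1)

theorem eval_centredPoly_pow {K : ℕ} (b : Fin K → ℝ) (j : ℕ) (x : Fin K → ℝ) :
    MvPolynomial.eval x (centredPoly b ^ j) = centredSum b x ^ j := by
  simp [centredPoly, centredSum]

theorem totalDegree_centredPoly_pow_le {K : ℕ} (b : Fin K → ℝ) (j : ℕ) :
    (centredPoly b ^ j).totalDegree ≤ j := by
  have h : (centredPoly b).totalDegree ≤ 1 := by
    refine MvPolynomial.totalDegree_finsetSum_le fun i _ => ?_
    refine (MvPolynomial.totalDegree_mul _ _).trans ?_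
    rw [MvPolynomial.totalDegree_C, zero_add]
    refine (MvPolynomial.totalDegree_sub _ _).trans ?_
    simp [MvPolynomial.totalDegree_X]
  calc (centredPoly b ^ j).totalDegree ≤ j * (centredPoly b).totalDegree :=
        MvPolynomial.totalDegree_pow _ _
    _ ≤ j * 1 := Nat.mul_le_mul_left _ h
    _ = j := mul_one j

theorem continuous_centredSum_traceSq {N K : ℕ} (b : Fin K → ℝ) :
    Continuous fun θ : Fin N → Torus => centredSum b (traceSq K θ) :=
  continuous_finsetSum _ fun i _ =>
    continuous_const.mul (((continuous_apply i).comp continuous_traceSq).sub continuous_const)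

theorem integrable_centredSum_pow {K : ℕ} (b : Fin K → ℝ) (j : ℕ) :
    Integrable (fun x => centredSum b x ^ j) (expProduct K) := by
  simp only [← eval_centredPoly_pow]
  exact integrable_eval_expProduct _

theorem integral_centredSum_traceSq_pow {N K m j : ℕ} (hm : m * K ≤ N) (hj : j ≤ m)
    (b : Fin K → ℝ) :
    ∫ θ, centredSum b (traceSq K θ) ^ j ∂(cueMeasure N)
      = ∫ x, centredSum b x ^ j ∂(expProduct K) := by
  simp only [← eval_centredPoly_pow]
  exact integral_eval_traceSq hm _ ((totalDegree_centredPoly_pow_le b j).trans hj)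

theorem integral_norm_sq_powerSum {N k : ℕ} (hk : 0 < k) (hkN : k ≤ N) :
    ∫ θ : Fin N → Torus, ‖powerSum (k : ℤ) θ‖ ^ 2 ∂(cueMeasure N) = k := by
  have h := integral_prod_norm_sq_powerSum_pow (N := N) (Finsupp.single k 1) (fun j hj => by
    rw [Finsupp.support_single _ one_ne_zero, Finset.mem_singleton] at hj
    omega) (by rw [Finsupp.sum_single_index (by simp)]; omega)
  rw [Finsupp.support_single _ one_ne_zero] at h
  simpa using h

/-- Quantitative central limit theorem for `∑_{k ≤ K} b_k (|T_k|² / k - 1)`: comparing `m` moments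
is possible as soon as `m K ≤ N`. -/
theorem norm_charFun_traceSq_sub_le {N K m : ℕ} (hmN : m * K ≤ N) (hm : Even m) (b : Fin K → ℝ)
    {t s β : ℝ} (hs : 0 < s) (hβ : ∀ i, |b i| ≤ β) (hsβ : s * β ≤ 1 / 2)
    (htβ : |t| * β ≤ 1 / 2) (hsmall : |t| ^ 3 * β * ∑ i, b i ^ 2 ≤ 1) :
    ‖∫ θ, Complex.exp (t * Complex.I * (centredSum b (traceSq K θ) : ℂ)) ∂(cueMeasure N)
        - Complex.exp ((-(t ^ 2 * (∑ i, b i ^ 2) / 2) : ℝ) : ℂ)‖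
      ≤ 4 * Real.exp (s ^ 2 * ∑ i, b i ^ 2) * (|t| / s) ^ m
        + 2 * (|t| ^ 3 * β * ∑ i, b i ^ 2) := by
  have hsb (i : Fin K) : |s * b i| ≤ 1 / 2 := by
    rw [abs_mul, abs_of_pos hs]
    exact (mul_le_mul_of_nonneg_left (hβ i) hs.le).trans hsβ
  have hmeas : AEMeasurable (centredSum b) (expProduct K) := by
    have := (integrable_centredSum_pow b 1).aestronglyMeasurable.aemeasurable
    simpa using this
  have h1 := norm_integral_cexp_sub_le (μ := cueMeasure N) (ν := expProduct K)
    (continuous_centredSum_traceSq b).measurable.aemeasurable hmeas t hm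
    (fun j _ => integrable_cueMeasure_of_continuous ((continuous_centredSum_traceSq b).pow j))
    (fun j _ => integrable_centredSum_pow b j)
    (fun j hj => integral_centredSum_traceSq_pow hmN hj b)
  have h2 := norm_charFun_centredSum_sub_le b hβ htβ hsmall
  have h3 := integral_pow_centredSum_le b hs hsb hm (integrable_centredSum_pow b m)
  have h4 : 2 * (|t| ^ m * (∫ x, centredSum b x ^ m ∂(expProduct K)) / m.factorial)
      ≤ 4 * Real.exp (s ^ 2 * ∑ i, b i ^ 2) * (|t| / s) ^ m := by
    rw [mul_div_assoc]
    calc 2 * (|t| ^ m * ((∫ x, centredSum b x ^ m ∂(expProduct K)) / m.factorial))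
        ≤ 2 * (|t| ^ m * (2 * Real.exp (s ^ 2 * ∑ i, b i ^ 2) / s ^ m)) := by gcongr
      _ = _ := by
        rw [div_pow]
        ring
  refine (norm_sub_le_norm_sub_add_norm_sub _
    (∫ x, Complex.exp (t * Complex.I * (centredSum b x : ℂ)) ∂(expProduct K)) _).trans ?_
  linarith

/-! ### Consequences of slow variation -/

/-- The partial sums `2 ∑_{k ≤ n} k² w_k`. -/
def weightedVar (w : ℕ → ℝ) (n : ℕ) : ℝ := 2 * ∑ k ∈ Finset.Ioc 0 n, (k : ℝ) ^ 2 * w k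

theorem weightedVar_sub (w : ℕ → ℝ) {m n : ℕ} (h : m ≤ n) :
    2 * ∑ k ∈ Finset.Ioc m n, (k : ℝ) ^ 2 * w k = weightedVar w n - weightedVar w m := by
  rw [weightedVar, weightedVar, ← Finset.sum_Ioc_consecutive _ (Nat.zero_le m) h]
  ring

theorem monotone_weightedVar {w : ℕ → ℝ} (hw : ∀ k, 0 ≤ w k) : Monotone (weightedVar w) := by
  intro m n h
  rw [← sub_nonneg, ← weightedVar_sub w h]
  exact mul_nonneg zero_le_two (Finset.sum_nonneg fun k _ => mul_nonneg (sq_nonneg _) (hw k))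

theorem SlowlyVarying.tendsto_div {V : ℕ → ℝ} (h : SlowlyVarying V) {m : ℕ} (hm : 0 < m) :
    Tendsto (fun N : ℕ => V (N / m) / V N) atTop (𝓝 1) := by
  have h1 := h.2 (1 / (m : ℝ)) (by positivity)
  refine h1.congr fun N => ?_
  rw [one_div_mul_eq_div, Nat.floor_div_eq_div]

theorem SlowlyVarying.eventually_sub_le {V : ℕ → ℝ} (h : SlowlyVarying V) {m : ℕ} (hm : 0 < m)
    {ε : ℝ} (hε : 0 < ε) : ∀ᶠ N in atTop, V N - V (N / m) ≤ ε * V N := by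
  filter_upwards [h.1, (h.tendsto_div hm).eventually (lt_mem_nhds (show 1 - ε < 1 by linarith))]
    with N hN h1
  rw [lt_div_iff₀ hN] at h1
  linarith

theorem SlowlyVarying.eventually_two_mul_le {V : ℕ → ℝ} (h : SlowlyVarying V)
    {ε : ℝ} (hε : 0 < ε) : ∀ᶠ N in atTop, V (2 * N) - V N ≤ ε * V N := by
  have h2 : Tendsto (fun N : ℕ => V (2 * N) / V N) atTop (𝓝 1) := by
    refine (h.2 2 two_pos).congr fun N => ?_
    rw [show (2 : ℝ) * N = ((2 * N : ℕ) : ℝ) by push_cast; rfl, Nat.floor_natCast]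
  filter_upwards [h.1, h2.eventually (gt_mem_nhds (show 1 < 1 + ε by linarith))] with N hN h1
  rw [div_lt_iff₀ hN] at h1
  linarith

/-- The single terms are negligible compared to the sum. -/
theorem eventually_sq_mul_le {w : ℕ → ℝ} (hw : ∀ k, 0 ≤ w k) (h : SlowlyVarying (weightedVar w))
    (htop : Tendsto (weightedVar w) atTop atTop) {ε : ℝ} (hε : 0 < ε) :
    ∀ᶠ K : ℕ in atTop, ∀ k ∈ Finset.Ioc 0 K, (k : ℝ) ^ 2 * w k ≤ ε * weightedVar w K := by
  have hmono := monotone_weightedVar hw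
  have hterm {m k : ℕ} (hm : m < k) :
      2 * ((k : ℝ) ^ 2 * w k) ≤ weightedVar w k - weightedVar w m := by
    rw [← weightedVar_sub w hm.le]
    gcongr
    exact Finset.single_le_sum (f := fun k : ℕ => (k : ℝ) ^ 2 * w k)
      (fun j _ => mul_nonneg (sq_nonneg _) (hw j)) (Finset.mem_Ioc.mpr ⟨hm, le_rfl⟩)
  have h00 : weightedVar w 0 = 0 := by simp [weightedVar]
  obtain ⟨n₀, hn₀⟩ := eventually_atTop.mp (h.eventually_sub_le two_pos hε)
  filter_upwards [htop.eventually_ge_atTop (weightedVar w n₀ / ε)] with K hK k hk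
  rw [Finset.mem_Ioc] at hk
  have hnn : 0 ≤ (k : ℝ) ^ 2 * w k := mul_nonneg (sq_nonneg _) (hw k)
  rcases le_total n₀ k with hkn | hkn
  · have h1 := hn₀ k hkn
    have h2 := hterm (m := k / 2) (k := k) (by omega)
    have h3 := mul_le_mul_of_nonneg_left (hmono hk.2) hε.le
    linarith
  · have h1 := hterm (m := 0) hk.1
    have h2 := hmono hkn
    rw [div_le_iff₀ hε] at hK
    linarith

/-- Dyadic estimate for the tail `N² ∑_{k > N} w_k`. -/
theorem sq_mul_sum_Ioc_two_pow_le {w : ℕ → ℝ} (hw : ∀ k, 0 ≤ w k) {ε : ℝ} (hε : 0 < ε)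
    (hε1 : ε ≤ 1) {n₀ : ℕ}
    (h : ∀ n ≥ n₀, weightedVar w (2 * n) - weightedVar w n ≤ ε * weightedVar w n) {N : ℕ}
    (hN : n₀ ≤ N) (J : ℕ) :
    weightedVar w (2 ^ J * N) ≤ 2 ^ J * weightedVar w N ∧
      (N : ℝ) ^ 2 * ∑ k ∈ Finset.Ioc N (2 ^ J * N), w k
        ≤ ε * weightedVar w N * (1 - (1 / 2) ^ J) := by
  have hnn (n : ℕ) : 0 ≤ weightedVar w n :=
    mul_nonneg zero_le_two (Finset.sum_nonneg fun k _ => mul_nonneg (sq_nonneg _) (hw k))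
  induction J with
  | zero => simp
  | succ J ih =>
    have hle : N ≤ 2 ^ J * N := Nat.le_mul_of_pos_left _ (by positivity)
    have hdbl : 2 ^ (J + 1) * N = 2 * (2 ^ J * N) := by ring
    have h1 := h (2 ^ J * N) (hN.trans hle)
    have hle2 : 2 ^ J * N ≤ 2 * (2 ^ J * N) := by omega
    refine ⟨?_, ?_⟩
    · rw [hdbl, pow_succ']
      have h2 := mul_le_mul_of_nonneg_right hε1 (hnn (2 ^ J * N))
      linarith [ih.1]
    · rw [hdbl, ← Finset.sum_Ioc_consecutive _ hle hle2, mul_add]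
      have h2 : (4 : ℝ) ^ J * ((N : ℝ) ^ 2 * ∑ k ∈ Finset.Ioc (2 ^ J * N) (2 * (2 ^ J * N)), w k)
          ≤ ∑ k ∈ Finset.Ioc (2 ^ J * N) (2 * (2 ^ J * N)), (k : ℝ) ^ 2 * w k := by
        rw [← mul_assoc, Finset.mul_sum]
        refine Finset.sum_le_sum fun k hk => mul_le_mul_of_nonneg_right ?_ (hw k)
        have h3 : ((2 ^ J * N : ℕ) : ℝ) ≤ k := by
          exact_mod_cast (Finset.mem_Ioc.mp hk).1.le
        calc (4 : ℝ) ^ J * (N : ℝ) ^ 2 = ((2 ^ J * N : ℕ) : ℝ) ^ 2 := by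
              push_cast
              rw [mul_pow, ← pow_mul, mul_comm J 2, pow_mul]
              norm_num
          _ ≤ (k : ℝ) ^ 2 := by gcongr
      have h3 := weightedVar_sub w hle2
      have h4 : (4 : ℝ) ^ J * ((N : ℝ) ^ 2 *
          ∑ k ∈ Finset.Ioc (2 ^ J * N) (2 * (2 ^ J * N)), w k)
          ≤ ε * (2 ^ J * weightedVar w N) / 2 := by
        have := mul_le_mul_of_nonneg_left ih.1 hε.le
        linarith
      have h5 : (N : ℝ) ^ 2 * ∑ k ∈ Finset.Ioc (2 ^ J * N) (2 * (2 ^ J * N)), w k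
          ≤ ε * weightedVar w N * (1 / 2) ^ (J + 1) := by
        rw [← mul_le_mul_iff_right₀ (show (0 : ℝ) < 4 ^ J by positivity)]
        refine h4.trans (le_of_eq ?_)
        rw [show (4 : ℝ) = 2 * 2 by norm_num, mul_pow, pow_succ, one_div, inv_pow]
        field_simp
      have h6 := ih.2
      have h7 : ε * weightedVar w N * (1 - (1 / 2) ^ J) + ε * weightedVar w N * (1 / 2) ^ (J + 1)
          = ε * weightedVar w N * (1 - (1 / 2) ^ (J + 1)) := by
        rw [pow_succ]
        ring
      linarith

/-- The frequencies above a fixed proportion of `N` contribute negligibly to the variance. -/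
theorem eventually_sum_min_sq_le {w : ℕ → ℝ} (hw : ∀ k, 0 ≤ w k)
    (h : SlowlyVarying (weightedVar w)) {m : ℕ} (hm : 0 < m) {ε : ℝ} (hε : 0 < ε) :
    ∀ᶠ N in atTop, ∀ M,
      ∑ k ∈ Finset.Ioc (N / m) M, w k * (min k N : ℕ) ^ 2 ≤ ε * weightedVar w N := by
  set δ := min ε 1 / 2 with hδ
  have hδ0 : 0 < δ := by positivity
  have hδ1 : δ ≤ 1 := by
    have := min_le_right ε 1
    linarith
  have hδε : 2 * δ ≤ ε := by
    have := min_le_left ε 1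
    linarith
  obtain ⟨n₀, hn₀⟩ := eventually_atTop.mp (h.eventually_two_mul_le hδ0)
  filter_upwards [h.eventually_sub_le hm hδ0, eventually_ge_atTop n₀, eventually_ge_atTop 1]
    with N h1 hN hN1 M
  have hnn : 0 ≤ weightedVar w N :=
    mul_nonneg zero_le_two (Finset.sum_nonneg fun k _ => mul_nonneg (sq_nonneg _) (hw k))
  have hK : N / m ≤ N := Nat.div_le_self _ _
  have hle : N ≤ 2 ^ M * N := Nat.le_mul_of_pos_left _ (by positivity)
  have hM : M ≤ 2 ^ M * N := Nat.lt_two_pow_self.le.trans (Nat.le_mul_of_pos_right _ hN1)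
  have h2 := (sq_mul_sum_Ioc_two_pow_le hw hδ0 hδ1 hn₀ hN M).2
  have h3 : ∑ k ∈ Finset.Ioc (N / m) N, w k * (min k N : ℕ) ^ 2 ≤ δ * weightedVar w N := by
    have h4 := weightedVar_sub w hK
    have h5 : ∑ k ∈ Finset.Ioc (N / m) N, w k * (min k N : ℕ) ^ 2
        = ∑ k ∈ Finset.Ioc (N / m) N, (k : ℝ) ^ 2 * w k :=
      Finset.sum_congr rfl fun k hk => by
        rw [min_eq_left (Finset.mem_Ioc.mp hk).2, mul_comm]
    have h6 : 0 ≤ ∑ k ∈ Finset.Ioc (N / m) N, (k : ℝ) ^ 2 * w k :=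
      Finset.sum_nonneg fun k _ => mul_nonneg (sq_nonneg _) (hw k)
    rw [h5]
    linarith
  have h7 : ∑ k ∈ Finset.Ioc N (2 ^ M * N), w k * (min k N : ℕ) ^ 2 ≤ δ * weightedVar w N := by
    have h5 : ∑ k ∈ Finset.Ioc N (2 ^ M * N), w k * (min k N : ℕ) ^ 2
        = (N : ℝ) ^ 2 * ∑ k ∈ Finset.Ioc N (2 ^ M * N), w k := by
      rw [Finset.mul_sum]
      exact Finset.sum_congr rfl fun k hk => by
        rw [min_eq_right (Finset.mem_Ioc.mp hk).1.le, mul_comm]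
    rw [h5]
    refine h2.trans (mul_le_of_le_one_right (mul_nonneg hδ0.le hnn) ?_)
    have : (0 : ℝ) ≤ (1 / 2) ^ M := by positivity
    linarith
  calc ∑ k ∈ Finset.Ioc (N / m) M, w k * (min k N : ℕ) ^ 2
      ≤ ∑ k ∈ Finset.Ioc (N / m) (2 ^ M * N), w k * (min k N : ℕ) ^ 2 :=
        Finset.sum_le_sum_of_subset_of_nonneg (Finset.Ioc_subset_Ioc_right hM)
          fun k _ _ => mul_nonneg (hw k) (sq_nonneg _)
    _ = ∑ k ∈ Finset.Ioc (N / m) N, w k * (min k N : ℕ) ^ 2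
        + ∑ k ∈ Finset.Ioc N (2 ^ M * N), w k * (min k N : ℕ) ^ 2 :=
        (Finset.sum_Ioc_consecutive _ hK hle).symm
    _ ≤ 2 * δ * weightedVar w N := by linarith
    _ ≤ ε * weightedVar w N := mul_le_mul_of_nonneg_right hδε hnn

/-! ### Fourier series of the test function -/

/-- The cosine coefficient `f̂(k)` of an even real function. -/
def cosCoeff (f : Torus → ℝ) (k : ℤ) : ℝ := (fourierCoeff (fun x => (f x : ℂ)) k).re

theorem fourierCoeff_neg_of_even {f : Torus → ℝ} (heven : ∀ᵐ x : Torus, f (-x) = f x) (k : ℤ) :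
    fourierCoeff (fun x => (f x : ℂ)) (-k) = fourierCoeff (fun x => (f x : ℂ)) k := by
  rw [fourierCoeff, fourierCoeff, AddCircle.integral_haarAddCircle,
    AddCircle.integral_haarAddCircle]
  congr 1
  rw [← integral_neg_eq_self (fun t : Torus => fourier (-k) t • (f t : ℂ))]
  refine integral_congr_ae ?_
  filter_upwards [heven] with x hx
  rw [hx]
  simp [fourier_apply]

theorem fourierCoeff_neg_eq_conj (f : Torus → ℝ) (k : ℤ) :
    fourierCoeff (fun x => (f x : ℂ)) (-k) = conj (fourierCoeff (fun x => (f x : ℂ)) k) := by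
  rw [fourierCoeff, fourierCoeff, ← integral_conj]
  refine integral_congr_ae (ae_of_all _ fun x => ?_)
  simp

theorem fourierCoeff_eq_cosCoeff {f : Torus → ℝ} (heven : ∀ᵐ x : Torus, f (-x) = f x) (k : ℤ) :
    fourierCoeff (fun x => (f x : ℂ)) k = (cosCoeff f k : ℂ) := by
  have h := fourierCoeff_neg_eq_conj f k
  rw [fourierCoeff_neg_of_even heven] at h
  exact (Complex.conj_eq_iff_re.mp h.symm).symm

theorem cosCoeff_neg {f : Torus → ℝ} (heven : ∀ᵐ x : Torus, f (-x) = f x) (k : ℤ) :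
    cosCoeff f (-k) = cosCoeff f k := by
  rw [cosCoeff, fourierCoeff_neg_of_even heven, cosCoeff]

theorem sum_Icc_neg_eq {M : Type*} [AddCommMonoid M] (g : ℤ → M) (n : ℕ) :
    ∑ k ∈ Finset.Icc (-(n : ℤ)) n, g k = g 0 + ∑ k ∈ Finset.Ioc 0 n, (g k + g (-(k : ℤ))) := by
  induction n with
  | zero => simp
  | succ n ih =>
    have h1 : Finset.Icc (-((n + 1 : ℕ) : ℤ)) ((n + 1 : ℕ) : ℤ)
        = insert ((n + 1 : ℕ) : ℤ) (insert (-((n + 1 : ℕ) : ℤ)) (Finset.Icc (-(n : ℤ)) n)) := by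
      ext x
      simp only [Finset.mem_Icc, Finset.mem_insert]
      omega
    have h2 : Finset.Ioc 0 (n + 1) = insert (n + 1) (Finset.Ioc 0 n) := by
      ext x
      simp only [Finset.mem_Ioc, Finset.mem_insert]
      omega
    rw [h1, h2, Finset.sum_insert, Finset.sum_insert, Finset.sum_insert, ih]
    · abel
    · simp
    · simp only [Finset.mem_Icc]
      omega
    · simp only [Finset.mem_insert, Finset.mem_Icc]
      omega

theorem truncVar_eq_weightedVar {f : Torus → ℝ} (heven : ∀ᵐ x : Torus, f (-x) = f x) :
    truncVar f = weightedVar fun k => cosCoeff f k ^ 2 := by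
  ext n
  rw [truncVar, sum_Icc_neg_eq, weightedVar, Finset.mul_sum]
  simp only [fourierCoeff_eq_cosCoeff heven, cosCoeff_neg heven, Complex.norm_real,
    Real.norm_eq_abs, sq_abs]
  simp only [Int.cast_zero, ne_eq, OfNat.ofNat_ne_zero, not_false_eq_true, zero_pow, mul_zero,
    zero_add]
  refine Finset.sum_congr rfl fun k _ => ?_
  push_cast
  ring

/-- The partial sums `f̂(0) + 2 ∑_{k ≤ M} f̂(k) cos(k x)` of the Fourier series of an even
function. -/
def fourierPartial (f : Torus → ℝ) (M : ℕ) (x : Torus) : ℝ :=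
  cosCoeff f 0 + ∑ k ∈ Finset.Ioc 0 M, 2 * cosCoeff f k * (fourier (k : ℤ) x : ℂ).re

theorem fourierPartial_coe {f : Torus → ℝ} (heven : ∀ᵐ x : Torus, f (-x) = f x) (M : ℕ)
    (x : Torus) :
    (fourierPartial f M x : ℂ)
      = ∑ k ∈ Finset.Icc (-(M : ℤ)) M, fourierCoeff (fun x => (f x : ℂ)) k * fourier k x := by
  rw [sum_Icc_neg_eq, fourierPartial]
  simp only [fourierCoeff_eq_cosCoeff heven, cosCoeff_neg heven]
  push_cast
  rw [fourier_zero, mul_one]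
  congr 1
  refine Finset.sum_congr rfl fun k _ => ?_
  rw [fourier_neg, ← mul_add, Complex.add_conj]
  push_cast
  ring

theorem continuous_fourierPartial (f : Torus → ℝ) (M : ℕ) : Continuous (fourierPartial f M) :=
  continuous_const.add (continuous_finsetSum _ fun k _ =>
    continuous_const.mul (Complex.continuous_re.comp (fourier (k : ℤ)).continuous))

/-- The Fourier series converges in mean. -/
theorem tendsto_integral_abs_sub_fourierPartial {f : Torus → ℝ} (hf : MemLp f 2 volume)
    (heven : ∀ᵐ x : Torus, f (-x) = f x) :
    Tendsto (fun M => ∫ x, |f x - fourierPartial f M x|) atTop (𝓝 0) := by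
  have hF : MemLp (fun x => (f x : ℂ)) 2 (AddCircle.haarAddCircle (T := 2 * Real.pi)) :=
    (hf.ofReal (K := ℂ)).haarAddCircle
  set F := hF.toLp with hFdef
  have h1 := (hasSum_fourier_series_L2 F).comp (Finset.tendsto_Icc_neg (R := ℤ))
  have hcoeff (k : ℤ) : fourierCoeff F k = fourierCoeff (fun x => (f x : ℂ)) k :=
    congrFun (fourierCoeff_congr_ae hF.coeFn_toLp) k
  simp only [hcoeff] at h1
  rw [tendsto_iff_norm_sub_tendsto_zero] at h1
  have h2 (M : ℕ) : ∫ x, |f x - fourierPartial f M x|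
      ≤ 2 * Real.pi * ‖((fun s : Finset ℤ => ∑ b ∈ s,
          fourierCoeff (fun x => (f x : ℂ)) b • (fourierLp 2 b : Lp ℂ 2 _)) ∘
          fun n : ℕ => Finset.Icc (-(n : ℤ)) n) M - F‖ := by
    set G : Lp ℂ 2 (AddCircle.haarAddCircle (T := 2 * Real.pi)) :=
      ∑ b ∈ Finset.Icc (-(M : ℤ)) M,
        fourierCoeff (fun x => (f x : ℂ)) b • (fourierLp 2 b : Lp ℂ 2 _) with hG
    change _ ≤ 2 * Real.pi * ‖G - F‖
    have hGae : (G : Torus → ℂ) =ᵐ[AddCircle.haarAddCircle]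
        fun x => (fourierPartial f M x : ℂ) := by
      have h3 : ∀ b ∈ Finset.Icc (-(M : ℤ)) M,
          ((fourierCoeff (fun x => (f x : ℂ)) b • (fourierLp 2 b : Lp ℂ 2 _) :
            Lp ℂ 2 (AddCircle.haarAddCircle (T := 2 * Real.pi))) : Torus → ℂ)
          =ᵐ[AddCircle.haarAddCircle]
            fun x => fourierCoeff (fun x => (f x : ℂ)) b * fourier b x := by
        intro b _
        filter_upwards [Lp.coeFn_smul (fourierCoeff (fun x => (f x : ℂ)) b)
          (fourierLp 2 b : Lp ℂ 2 (AddCircle.haarAddCircle (T := 2 * Real.pi))),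
          coeFn_fourierLp (T := 2 * Real.pi) 2 b] with x hx hx2
        rw [hx, Pi.smul_apply, hx2, smul_eq_mul]
      have h4 := (Finset.eventually_all _).mpr h3
      filter_upwards [Lp.coeFn_finsetSum (Finset.Icc (-(M : ℤ)) M) fun b =>
        fourierCoeff (fun x => (f x : ℂ)) b • (fourierLp 2 b : Lp ℂ 2
          (AddCircle.haarAddCircle (T := 2 * Real.pi))), h4] with x hx hx4
      rw [hG, hx, Finset.sum_apply, fourierPartial_coe heven]
      exact Finset.sum_congr rfl fun b hb => hx4 b hb
    have h5 : ∫ x, |f x - fourierPartial f M x|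
        = 2 * Real.pi * ∫ x, ‖(G - F) x‖ ∂(AddCircle.haarAddCircle (T := 2 * Real.pi)) := by
      have h6 : ∫ x, ‖(G - F) x‖ ∂(AddCircle.haarAddCircle (T := 2 * Real.pi))
          = ∫ x, |f x - fourierPartial f M x| ∂(AddCircle.haarAddCircle (T := 2 * Real.pi)) := by
        refine integral_congr_ae ?_
        filter_upwards [Lp.coeFn_sub G F, hGae, hF.coeFn_toLp] with x hx1 hx2 hx3
        rw [hx1, Pi.sub_apply, hx2, hFdef, hx3, ← Complex.ofReal_sub, Complex.norm_real,
          Real.norm_eq_abs, abs_sub_comm]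
      rw [h6, AddCircle.integral_haarAddCircle, smul_eq_mul,
        mul_inv_cancel_left₀ Real.two_pi_pos.ne']
    rw [h5]
    refine mul_le_mul_of_nonneg_left ?_ Real.two_pi_pos.le
    have hmem := Lp.memLp (G - F)
    have h7 := eLpNorm_le_eLpNorm_of_exponent_le (p := 1) (q := 2) one_le_two
      hmem.aestronglyMeasurable
    rw [Lp.norm_def, integral_norm_eq_lintegral_enorm hmem.aestronglyMeasurable,
      ← eLpNorm_one_eq_lintegral_enorm]
    exact ENNReal.toReal_mono hmem.eLpNorm_lt_top.ne h7
  refine squeeze_zero (fun M => integral_nonneg fun x => abs_nonneg _) h2 ?_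
  simpa using h1.const_mul (2 * Real.pi)

/-! ### The pair statistic in terms of the traces -/

/-- The law of `θ_i - θ_j` under Lebesgue measure is a multiple of Lebesgue measure. -/
theorem exists_measurePreserving_sub {N : ℕ} {i j : Fin N} (hij : i ≠ j) :
    ∃ C : ENNReal, C ≠ ⊤ ∧ C ≠ 0 ∧ MeasurePreserving (fun θ : Fin N → Torus => θ i - θ j) volume
      (C • (volume : Measure Torus)) := by
  have h0 : (volume : Measure Torus) Set.univ ≠ 0 :=
    (Measure.measure_univ_ne_zero).mpr (NeZero.ne _)
  have h0' : (volume : Measure (Fin N → Torus)) Set.univ ≠ 0 :=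
    (Measure.measure_univ_ne_zero).mpr (NeZero.ne _)
  have ht : (volume : Measure Torus) Set.univ ≠ ⊤ := measure_ne_top _ _
  have ht' : (volume : Measure (Fin N → Torus)) Set.univ ≠ ⊤ := measure_ne_top _ _
  set C := (volume : Measure (Fin N → Torus)) Set.univ / (volume : Measure Torus) Set.univ with hC
  have hC0 : C ≠ 0 := (ENNReal.div_pos h0' ht).ne'
  have hCt : C ≠ ⊤ := ENNReal.div_ne_top ht' h0
  refine ⟨C, hCt, hC0, ?_⟩
  have : (C • (volume : Measure Torus)).IsAddHaarMeasure :=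
    Measure.IsAddHaarMeasure.smul _ hC0 hCt
  refine AddMonoidHom.measurePreserving (μ := (volume : Measure (Fin N → Torus)))
    (ν := C • (volume : Measure Torus))
    (f := (Pi.evalAddMonoidHom (fun _ : Fin N => Torus) i - Pi.evalAddMonoidHom _ j))
    ((continuous_apply i).sub (continuous_apply j)) ?_ ?_
  · intro x
    refine ⟨Pi.single i x, ?_⟩
    simp [Pi.single_eq_of_ne hij.symm]
  · rw [Measure.smul_apply, smul_eq_mul, hC, ENNReal.div_mul_cancel h0 ht]

theorem integrable_comp_sub {N : ℕ} {i j : Fin N} (hij : i ≠ j) {h : Torus → ℝ}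
    (hh : Integrable h volume) :
    Integrable (fun θ : Fin N → Torus => h (θ i - θ j)) volume := by
  obtain ⟨C, hCt, -, hmp⟩ := exists_measurePreserving_sub hij
  exact hmp.integrable_comp_of_integrable (hh.smul_measure hCt)

theorem integrable_pairStat {h : Torus → ℝ} (hh : Integrable h volume) (N : ℕ) :
    Integrable (pairStat h N) (cueMeasure N) := by
  obtain ⟨C, hC⟩ := exists_cueMeasure_le N
  refine Integrable.mono_measure (Integrable.smul_measure ?_ ENNReal.coe_ne_top) hC
  exact integrable_finsetSum _ fun p hp => integrable_comp_sub (Finset.mem_offDiag.mp hp).2.2 hh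

/-- The pair statistic is continuous in mean as a function of the test function. -/
theorem exists_integral_abs_pairStat_le (N : ℕ) :
    ∃ C : ℝ, ∀ h : Torus → ℝ, Integrable h volume →
      ∫ θ, |pairStat h N θ| ∂(cueMeasure N) ≤ C * ∫ x, |h x| := by
  obtain ⟨D, hD⟩ := exists_cueMeasure_le N
  have hC (p : Fin N × Fin N) : ∃ C : ℝ, p.1 ≠ p.2 → ∀ h : Torus → ℝ, Integrable h volume →
      ∫ θ : Fin N → Torus, |h (θ p.1 - θ p.2)| = C * ∫ x, |h x| := by
    by_cases hp : p.1 = p.2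
    · exact ⟨0, fun h => absurd hp h⟩
    obtain ⟨C, hCt, -, hmp⟩ := exists_measurePreserving_sub hp
    refine ⟨C.toReal, fun _ h hh => ?_⟩
    have h1 : AEStronglyMeasurable (fun x => |h x|)
        (Measure.map (fun θ : Fin N → Torus => θ p.1 - θ p.2) volume) := by
      rw [hmp.map_eq]
      exact (hh.abs.smul_measure hCt).aestronglyMeasurable
    rw [← integral_map hmp.measurable.aemeasurable h1, hmp.map_eq, integral_smul_measure,
      smul_eq_mul]
  choose C hC using hC
  refine ⟨D * ∑ p ∈ (Finset.univ : Finset (Fin N)).offDiag, C p, fun h hh => ?_⟩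
  have hint (p : Fin N × Fin N) (hp : p ∈ (Finset.univ : Finset (Fin N)).offDiag) :
      Integrable (fun θ : Fin N → Torus => |h (θ p.1 - θ p.2)|) volume :=
    (integrable_comp_sub (Finset.mem_offDiag.mp hp).2.2 hh).abs
  have hint2 := integrable_finsetSum _ hint
  calc ∫ θ, |pairStat h N θ| ∂(cueMeasure N)
      ≤ ∫ θ, ∑ p ∈ (Finset.univ : Finset (Fin N)).offDiag, |h (θ p.1 - θ p.2)| ∂(cueMeasure N) := by
        refine integral_mono (integrable_pairStat hh N).abs
          ((hint2.smul_measure ENNReal.coe_ne_top).mono_measure hD) fun θ => ?_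
        exact Finset.abs_sum_le_sum_abs _ _
    _ ≤ ∫ θ, ∑ p ∈ (Finset.univ : Finset (Fin N)).offDiag, |h (θ p.1 - θ p.2)|
          ∂((D : ENNReal) • (volume : Measure (Fin N → Torus))) := by
        refine integral_mono_measure hD (ae_of_all _ fun θ => ?_)
          (hint2.smul_measure ENNReal.coe_ne_top)
        exact Finset.sum_nonneg fun p _ => abs_nonneg _
    _ = D * (∑ p ∈ (Finset.univ : Finset (Fin N)).offDiag, C p) * ∫ x, |h x| := by
        rw [integral_smul_measure, integral_finsetSum _ hint, smul_eq_mul, ENNReal.coe_toReal,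
          mul_assoc, Finset.sum_mul]
        congr 1
        exact Finset.sum_congr rfl fun p hp => hC p (Finset.mem_offDiag.mp hp).2.2 h hh

theorem sum_offDiag_fourier {N : ℕ} (k : ℤ) (θ : Fin N → Torus) :
    ∑ p ∈ (Finset.univ : Finset (Fin N)).offDiag, (fourier k (θ p.1 - θ p.2) : ℂ).re
      = ‖powerSum k θ‖ ^ 2 - N := by
  have h1 : ∑ p ∈ (Finset.univ : Finset (Fin N)) ×ˢ (Finset.univ : Finset (Fin N)),
      (fourier k (θ p.1 - θ p.2) : ℂ) = ((‖powerSum k θ‖ ^ 2 : ℝ) : ℂ) := by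
    push_cast
    rw [← Complex.mul_conj', powerSum, map_sum, Finset.sum_mul_sum, Finset.sum_product]
    refine Finset.sum_congr rfl fun i _ => Finset.sum_congr rfl fun j _ => ?_
    simp only
    rw [← fourier_neg, fourier_apply, fourier_apply, fourier_apply, smul_sub, sub_eq_add_neg,
      AddCircle.toCircle_add, neg_smul, Circle.coe_mul]
  have h2 := congrArg Complex.re h1
  rw [Complex.re_sum, Complex.ofReal_re, ← Finset.diag_union_offDiag,
    Finset.sum_union (Finset.disjoint_diag_offDiag _), Finset.sum_diag] at h2
  simp only [sub_self, fourier_eval_zero, Complex.one_re, Finset.sum_const, Finset.card_univ,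
    Fintype.card_fin, nsmul_eq_mul, mul_one] at h2
  linarith

/-- For a trigonometric polynomial the pair statistic is a combination of squared traces. -/
theorem pairStat_fourierPartial (f : Torus → ℝ) (M N : ℕ) :
    ∃ a : ℝ, ∀ θ : Fin N → Torus, pairStat (fourierPartial f M) N θ
      = a + ∑ k ∈ Finset.Ioc 0 M, 2 * cosCoeff f k * ‖powerSum (k : ℤ) θ‖ ^ 2 := by
  refine ⟨(Finset.univ : Finset (Fin N)).offDiag.card * cosCoeff f 0
    - ∑ k ∈ Finset.Ioc 0 M, 2 * cosCoeff f k * N, fun θ => ?_⟩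
  simp only [pairStat, fourierPartial]
  rw [Finset.sum_add_distrib, Finset.sum_comm, Finset.sum_const, nsmul_eq_mul]
  simp only [← Finset.mul_sum, sum_offDiag_fourier]
  rw [sub_add, ← Finset.sum_sub_distrib, sub_eq_add_neg, ← Finset.sum_neg_distrib]
  congr 1
  exact Finset.sum_congr rfl fun k _ => by ring

/-! ### Truncation of the high frequencies -/

/-- The centred low frequency part of the pair statistic. -/
def lowPart (f : Torus → ℝ) (K : ℕ) {N : ℕ} (θ : Fin N → Torus) : ℝ :=
  ∑ k ∈ Finset.Ioc 0 K, 2 * cosCoeff f k * (‖powerSum (k : ℤ) θ‖ ^ 2 - k)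

theorem continuous_lowPart (f : Torus → ℝ) (K N : ℕ) :
    Continuous (lowPart f K : (Fin N → Torus) → ℝ) :=
  continuous_finsetSum _ fun _ _ =>
    continuous_const.mul (((continuous_powerSum _).norm.pow 2).sub continuous_const)

theorem integral_lowPart (f : Torus → ℝ) {K N : ℕ} (hK : K ≤ N) :
    ∫ θ : Fin N → Torus, lowPart f K θ ∂(cueMeasure N) = 0 := by
  have hint (k : ℕ) : Integrable (fun θ : Fin N → Torus => ‖powerSum (k : ℤ) θ‖ ^ 2)
      (cueMeasure N) :=
    integrable_cueMeasure_of_continuous ((continuous_powerSum _).norm.pow 2)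
  simp only [lowPart]
  rw [integral_finsetSum]
  swap
  · exact fun k _ => ((hint k).sub (integrable_const _)).const_mul _
  refine Finset.sum_eq_zero fun k hk => ?_
  rw [Finset.mem_Ioc] at hk
  rw [integral_const_mul, integral_sub (hint k) (integrable_const _),
    integral_norm_sq_powerSum hk.1 (hk.2.trans hK)]
  simp

/-- The pair statistic is close in mean to its low frequency part; `r` is a free parameter. -/
theorem integral_abs_pairStat_sub_lowPart_le {f : Torus → ℝ} (hf : MemLp f 2 volume)
    (heven : ∀ᵐ x : Torus, f (-x) = f x) {K N : ℕ} (hK : K ≤ N) {B r : ℝ} (hr : 0 < r)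
    (hB : ∀ M, ∑ k ∈ Finset.Ioc K M, cosCoeff f k ^ 2 * (min k N : ℕ) ^ 2 ≤ B) :
    ∫ θ, |pairStat f N θ - ∫ η, pairStat f N η ∂(cueMeasure N) - lowPart f K θ| ∂(cueMeasure N)
      ≤ 8 * B / r + r := by
  have hfint : Integrable f volume := hf.integrable one_le_two
  have hS := integrable_pairStat hfint N
  have hL : Integrable (lowPart f K : (Fin N → Torus) → ℝ) (cueMeasure N) :=
    integrable_cueMeasure_of_continuous (continuous_lowPart f K N)
  set Z : (Fin N → Torus) → ℝ := fun θ => pairStat f N θ - lowPart f K θ with hZdef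
  have hZ : Integrable Z (cueMeasure N) := hS.sub hL
  have hEZ : ∫ θ, Z θ ∂(cueMeasure N) = ∫ η, pairStat f N η ∂(cueMeasure N) := by
    rw [hZdef, integral_sub hS hL, integral_lowPart f hK, sub_zero]
  have hcentre (a : ℝ) : ∫ θ, |Z θ - ∫ η, Z η ∂(cueMeasure N)| ∂(cueMeasure N)
      ≤ 2 * ∫ θ, |Z θ - a| ∂(cueMeasure N) := by
    have hZa : Integrable (fun θ => Z θ - a) (cueMeasure N) := hZ.sub (integrable_const a)
    have h1 : |∫ η, Z η ∂(cueMeasure N) - a| ≤ ∫ θ, |Z θ - a| ∂(cueMeasure N) := by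
      have : ∫ η, Z η ∂(cueMeasure N) - a = ∫ η, (Z η - a) ∂(cueMeasure N) := by
        rw [integral_sub hZ (integrable_const a)]
        simp
      rw [this]
      exact abs_integral_le_integral_abs
    calc ∫ θ, |Z θ - ∫ η, Z η ∂(cueMeasure N)| ∂(cueMeasure N)
        ≤ ∫ θ, (|Z θ - a| + |∫ η, Z η ∂(cueMeasure N) - a|) ∂(cueMeasure N) := by
          refine integral_mono (hZ.sub (integrable_const _)).abs
            (hZa.abs.add (integrable_const _)) fun θ => ?_
          simp only
          rw [abs_sub_comm (∫ η, Z η ∂(cueMeasure N)) a]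
          exact abs_sub_le _ _ _
      _ = ∫ θ, |Z θ - a| ∂(cueMeasure N) + |∫ η, Z η ∂(cueMeasure N) - a| := by
          rw [integral_add hZa.abs (integrable_const _)]
          simp
      _ ≤ _ := by linarith
  obtain ⟨C, hC⟩ := exists_integral_abs_pairStat_le N
  have hbound (M : ℕ) (hM : K ≤ M) :
      ∫ θ, |Z θ - ∫ η, Z η ∂(cueMeasure N)| ∂(cueMeasure N)
        ≤ 2 * (C * ∫ x, |f x - fourierPartial f M x|) + (8 * B / r + r) := by
    obtain ⟨a₁, ha₁⟩ := pairStat_fourierPartial f M N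
    obtain ⟨a₂, ha₂⟩ := exists_integral_sum_norm_sq_powerSum_le (N := N) (Finset.Ioc K M)
      (fun k hk => Nat.zero_lt_of_lt (Finset.mem_Ioc.mp hk).1) fun k => 2 * cosCoeff f k
    set R : (Fin N → Torus) → ℝ := fun θ =>
      ∑ k ∈ Finset.Ioc K M, 2 * cosCoeff f k * ‖powerSum (k : ℤ) θ‖ ^ 2 - a₂ with hR
    have hRc : Continuous R := (continuous_finsetSum _ fun k _ =>
      continuous_const.mul ((continuous_powerSum _).norm.pow 2)).sub continuous_const
    have hR2 : ∫ θ, R θ ^ 2 ∂(cueMeasure N) ≤ 8 * B := by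
      refine ha₂.trans ?_
      have h3 : ∑ k ∈ Finset.Ioc K M, (2 * cosCoeff f k) ^ 2 * ((min k N : ℕ) : ℝ) ^ 2
          = 4 * ∑ k ∈ Finset.Ioc K M, cosCoeff f k ^ 2 * ((min k N : ℕ) : ℝ) ^ 2 := by
        rw [Finset.mul_sum]
        exact Finset.sum_congr rfl fun k _ => by ring
      rw [h3]
      linarith [hB M]
    have hgint : Integrable (fourierPartial f M) volume :=
      (continuous_fourierPartial f M).integrable_of_hasCompactSupport
        (HasCompactSupport.of_compactSpace _)
    have hDint : Integrable (fun x => f x - fourierPartial f M x) volume := hfint.sub hgint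
    have hRi : Integrable (fun θ => R θ ^ 2 / (2 * r)) (cueMeasure N) :=
      (integrable_cueMeasure_of_continuous (hRc.pow 2)).div_const _
    have hRi2 : Integrable (fun θ => R θ ^ 2 / (2 * r) + r / 2) (cueMeasure N) :=
      hRi.add (integrable_const _)
    set a : ℝ := a₁ + a₂ + ∑ k ∈ Finset.Ioc 0 K, 2 * cosCoeff f k * k with ha
    have hdecomp (θ : Fin N → Torus) :
        Z θ - a = pairStat (fun x => f x - fourierPartial f M x) N θ + R θ := by
      have h4 : pairStat (fun x => f x - fourierPartial f M x) N θ
          = pairStat f N θ - pairStat (fourierPartial f M) N θ := by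
        simp only [pairStat, Finset.sum_sub_distrib]
      rw [h4, ha₁, ← Finset.sum_Ioc_consecutive _ (Nat.zero_le K) hM]
      simp only [hZdef, hR, ha, lowPart, mul_sub, Finset.sum_sub_distrib]
      ring
    refine (hcentre a).trans ?_
    have h5 : ∫ θ, |Z θ - a| ∂(cueMeasure N)
        ≤ ∫ θ, (|pairStat (fun x => f x - fourierPartial f M x) N θ| + (R θ ^ 2 / (2 * r) + r / 2))
          ∂(cueMeasure N) := by
      refine integral_mono (hZ.sub (integrable_const a)).abs
        ((integrable_pairStat hDint N).abs.add hRi2) fun θ => ?_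
      simp only
      rw [hdecomp]
      refine (abs_add_le _ _).trans (add_le_add_right ?_ _)
      have h6 : R θ ^ 2 / (2 * r) + r / 2 - |R θ| = (|R θ| - r) ^ 2 / (2 * r) := by
        rw [← sq_abs (R θ)]
        field_simp
        ring
      have h7 : 0 ≤ (|R θ| - r) ^ 2 / (2 * r) := by positivity
      linarith
    rw [integral_add (integrable_pairStat hDint N).abs hRi2,
      integral_add hRi (integrable_const _), integral_div] at h5
    simp only [integral_const, probReal_univ, one_smul] at h5
    have h8 := hC _ hDint
    have h9 : (∫ θ, R θ ^ 2 ∂(cueMeasure N)) / (2 * r) ≤ 8 * B / (2 * r) := by gcongr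
    have h10 : 8 * B / (2 * r) = 8 * B / r / 2 := by
      rw [mul_comm 2 r, div_mul_eq_div_div]
    linarith
  have hlim : Tendsto (fun M => 2 * (C * ∫ x, |f x - fourierPartial f M x|) + (8 * B / r + r))
      atTop (𝓝 (8 * B / r + r)) := by
    have := (((tendsto_integral_abs_sub_fourierPartial hf heven).const_mul C).const_mul
      2).add_const (8 * B / r + r)
    simpa using this
  have hfinal := ge_of_tendsto hlim ((eventually_ge_atTop K).mono hbound)
  rw [hEZ] at hfinal
  refine le_trans (le_of_eq ?_) hfinal
  refine integral_congr_ae (ae_of_all _ fun θ => ?_)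
  simp only [hZdef]
  congr 1
  ring

/-! ### The central limit theorem -/

theorem sum_Ioc_eq_sum_fin {M : Type*} [AddCommMonoid M] (g : ℕ → M) (K : ℕ) :
    ∑ k ∈ Finset.Ioc 0 K, g k = ∑ i : Fin K, g ((i : ℕ) + 1) := by
  rw [Fin.sum_univ_eq_sum_range (fun i => g (i + 1)) K]
  induction K with
  | zero => simp
  | succ K ih => rw [Finset.sum_Ioc_succ_top (Nat.zero_le K), ih, Finset.sum_range_succ]

/-- The coefficients of the normalised low frequency part. -/
def lowCoeff (f : Torus → ℝ) (N K : ℕ) (i : Fin K) : ℝ :=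
  2 * cosCoeff f ((i : ℕ) + 1 : ℕ) * ((i : ℕ) + 1 : ℕ) / √(2 * truncVar f N)

theorem centredSum_lowCoeff (f : Torus → ℝ) (N K : ℕ) (θ : Fin N → Torus) :
    centredSum (lowCoeff f N K) (traceSq K θ) = lowPart f K θ / √(2 * truncVar f N) := by
  rw [lowPart, sum_Ioc_eq_sum_fin, Finset.sum_div, centredSum]
  refine Finset.sum_congr rfl fun i _ => ?_
  have : (((i : ℕ) + 1 : ℕ) : ℝ) ≠ 0 := Nat.cast_ne_zero.mpr (Nat.succ_ne_zero _)
  simp only [lowCoeff, traceSq]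
  field_simp

theorem lowCoeff_sq {f : Torus → ℝ} {N : ℕ} (hV : 0 < truncVar f N) (K : ℕ) (i : Fin K) :
    lowCoeff f N K i ^ 2
      = 2 * ((((i : ℕ) + 1 : ℕ) : ℝ) ^ 2 * cosCoeff f ((i : ℕ) + 1 : ℕ) ^ 2) / truncVar f N := by
  rw [lowCoeff, div_pow, Real.sq_sqrt (by positivity)]
  field_simp

theorem sum_lowCoeff_sq {f : Torus → ℝ} (heven : ∀ᵐ x : Torus, f (-x) = f x) {N : ℕ}
    (hV : 0 < truncVar f N) (K : ℕ) :
    ∑ i, lowCoeff f N K i ^ 2 = truncVar f K / truncVar f N := by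
  simp only [lowCoeff_sq hV]
  rw [← Finset.sum_div, ← Finset.mul_sum, ← sum_Ioc_eq_sum_fin
    (fun k : ℕ => (k : ℝ) ^ 2 * cosCoeff f k ^ 2)]
  congr 1
  rw [truncVar_eq_weightedVar heven, weightedVar]

theorem norm_cexp_mul_I_sub_le (a b : ℝ) :
    ‖Complex.exp (a * Complex.I) - Complex.exp (b * Complex.I)‖ ≤ |a - b| := by
  have h := norm_exp_mul_I_sub_sum_le 1 (a - b)
  simp only [Finset.sum_range_one, pow_zero, Nat.factorial_zero, Nat.cast_one, div_one, pow_one,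
    Nat.factorial_one] at h
  have h2 : Complex.exp (a * Complex.I) - Complex.exp (b * Complex.I)
      = Complex.exp (b * Complex.I) * (Complex.exp (((a - b : ℝ) : ℂ) * Complex.I) - 1) := by
    rw [mul_sub, ← Complex.exp_add, mul_one]
    congr 2
    push_cast
    ring
  rw [h2, norm_mul, Complex.norm_exp_ofReal_mul_I, one_mul]
  exact h

theorem norm_integral_cexp_sub_integral_cexp_le {Ω : Type*} [MeasurableSpace Ω] {μ : Measure Ω}
    [IsProbabilityMeasure μ] {X Y : Ω → ℝ} (hX : Integrable X μ) (hY : Integrable Y μ) (t : ℝ) :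
    ‖∫ ω, Complex.exp (t * Complex.I * (X ω : ℂ)) ∂μ
        - ∫ ω, Complex.exp (t * Complex.I * (Y ω : ℂ)) ∂μ‖ ≤ |t| * ∫ ω, |X ω - Y ω| ∂μ := by
  have harg (x : ℝ) : (t : ℂ) * Complex.I * (x : ℂ) = ((t * x : ℝ) : ℂ) * Complex.I := by
    push_cast
    ring
  have hint {Z : Ω → ℝ} (hZ : Integrable Z μ) :
      Integrable (fun ω => Complex.exp (t * Complex.I * (Z ω : ℂ))) μ := by
    refine Integrable.of_bound (C := 1) ?_ (ae_of_all _ fun ω => ?_)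
    · exact (Complex.measurable_exp.comp_aemeasurable ((Complex.measurable_ofReal.comp_aemeasurable
        hZ.aestronglyMeasurable.aemeasurable).const_mul _)).aestronglyMeasurable
    · rw [harg, Complex.norm_exp_ofReal_mul_I]
  rw [← integral_sub (hint hX) (hint hY), ← integral_const_mul]
  refine norm_integral_le_of_norm_le ((hX.sub hY).abs.const_mul _) (ae_of_all _ fun ω => ?_)
  rw [harg, harg]
  refine (norm_cexp_mul_I_sub_le _ _).trans (le_of_eq ?_)
  rw [← mul_sub, abs_mul]

/-- The normalised and centred pair statistic. -/
def normalizedStat (f : Torus → ℝ) (N : ℕ) (θ : Fin N → Torus) : ℝ :=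
  (pairStat f N θ - ∫ η, pairStat f N η ∂(cueMeasure N)) / √(2 * truncVar f N)

theorem integrable_normalizedStat {f : Torus → ℝ} (hf : MemLp f 2 volume) (N : ℕ) :
    Integrable (normalizedStat f N) (cueMeasure N) :=
  ((integrable_pairStat (hf.integrable one_le_two) N).sub (integrable_const _)).div_const _

/-- Replacing the statistic by its low frequency part changes its characteristic function
little. -/
theorem norm_charFun_normalizedStat_sub_le {f : Torus → ℝ} (hf : MemLp f 2 volume)
    (heven : ∀ᵐ x : Torus, f (-x) = f x) {K N : ℕ} (hK : K ≤ N) (hV : 0 < truncVar f N) {η : ℝ}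
    (hη : 0 < η) (hB : ∀ M, ∑ k ∈ Finset.Ioc K M, cosCoeff f k ^ 2 * (min k N : ℕ) ^ 2
      ≤ η ^ 2 * truncVar f N) (t : ℝ) :
    ‖∫ θ, Complex.exp (t * Complex.I * (normalizedStat f N θ : ℂ)) ∂(cueMeasure N)
      - ∫ θ, Complex.exp (t * Complex.I *
          (centredSum (lowCoeff f N K) (traceSq K θ) : ℂ)) ∂(cueMeasure N)‖ ≤ |t| * (5 * η) := by
  refine (norm_integral_cexp_sub_integral_cexp_le (integrable_normalizedStat hf N)
    (integrable_cueMeasure_of_continuous (continuous_centredSum_traceSq _)) t).trans ?_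
  refine mul_le_mul_of_nonneg_left ?_ (abs_nonneg t)
  set σ := √(2 * truncVar f N) with hσ
  have hσ0 : 0 < σ := Real.sqrt_pos.mpr (by positivity)
  have hσ2 : σ ^ 2 = 2 * truncVar f N := Real.sq_sqrt (by positivity)
  have h1 := integral_abs_pairStat_sub_lowPart_le hf heven hK (mul_pos hη hσ0) hB
  have h2 (θ : Fin N → Torus) :
      |normalizedStat f N θ - centredSum (lowCoeff f N K) (traceSq K θ)|
      = |pairStat f N θ - ∫ η, pairStat f N η ∂(cueMeasure N) - lowPart f K θ| / σ := by
    rw [centredSum_lowCoeff, normalizedStat, ← hσ, ← sub_div, abs_div, abs_of_pos hσ0]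
  simp only [h2]
  rw [integral_div, div_le_iff₀ hσ0]
  refine h1.trans (le_of_eq ?_)
  have h3 : truncVar f N = σ ^ 2 / 2 := by linarith
  rw [h3]
  field_simp
  ring

theorem tendsto_charFun_normalizedStat {f : Torus → ℝ} (hf : MemLp f 2 volume)
    (heven : ∀ᵐ x : Torus, f (-x) = f x) (hslow : SlowlyVarying (truncVar f))
    (htop : Tendsto (truncVar f) atTop atTop) (t : ℝ) :
    Tendsto (fun N : ℕ =>
        ∫ θ, Complex.exp (t * Complex.I * (normalizedStat f N θ : ℂ)) ∂(cueMeasure N))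
      atTop (𝓝 (Complex.exp ((-(t ^ 2 / 2) : ℝ) : ℂ))) := by
  have hVw := truncVar_eq_weightedVar heven
  have hw (k : ℕ) : 0 ≤ cosCoeff f k ^ 2 := sq_nonneg _
  rw [Metric.tendsto_atTop']
  intro ε hε
  -- With `s > 2|t|`, comparing `m` moments costs an error of order `2^{-m}`, uniformly in `N`.
  set s : ℝ := 2 * |t| + 1 with hs
  have hs0 : 0 < s := by positivity
  have hts : |t| / s < 1 := by
    rw [div_lt_one hs0, hs]
    linarith [abs_nonneg t]
  have hts0 : 0 ≤ |t| / s := by positivity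
  have hpow : Tendsto (fun n : ℕ => 4 * Real.exp (s ^ 2) * (|t| / s) ^ n) atTop (𝓝 0) := by
    simpa using (tendsto_pow_atTop_nhds_zero_of_lt_one hts0 hts).const_mul (4 * Real.exp (s ^ 2))
  obtain ⟨n₀, hn₀⟩ := eventually_atTop.mp
    (hpow.eventually (gt_mem_nhds (show 0 < ε / 5 by positivity)))
  set m : ℕ := 2 * (n₀ + 1) with hmdef
  have hm : Even m := even_two_mul _
  have hm0 : 0 < m := by omega
  have hmε : 4 * Real.exp (s ^ 2) * (|t| / s) ^ m < ε / 5 := hn₀ m (by omega)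
  -- `δ` is the bound on the single coefficients that the Gaussian approximation needs.
  obtain ⟨δ, hδ0, hδs, hδt, hδ3, hδε⟩ : ∃ δ : ℝ, 0 < δ ∧ s * δ ≤ 1 / 2 ∧ |t| * δ ≤ 1 / 2 ∧
      |t| ^ 3 * δ ≤ 1 ∧ 2 * (|t| ^ 3 * δ) < ε / 5 := by
    have hc (c : ℝ) : Tendsto (fun δ : ℝ => c * δ) (𝓝[>] 0) (𝓝 0) := by
      have : Tendsto (fun δ : ℝ => c * δ) (𝓝 0) (𝓝 (c * 0)) := tendsto_id.const_mul c
      rw [mul_zero] at this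
      exact this.mono_left nhdsWithin_le_nhds
    have h1 := (hc s).eventually (ge_mem_nhds (show (0 : ℝ) < 1 / 2 by norm_num))
    have h2 := (hc |t|).eventually (ge_mem_nhds (show (0 : ℝ) < 1 / 2 by norm_num))
    have h3 := (hc (|t| ^ 3)).eventually (ge_mem_nhds (show (0 : ℝ) < 1 by norm_num))
    have h4 := (hc (|t| ^ 3)).eventually (gt_mem_nhds (show (0 : ℝ) < ε / 10 by positivity))
    obtain ⟨δ, ⟨⟨⟨⟨h1, h2⟩, h3⟩, h4⟩, h5⟩⟩ :=
      ((((h1.and h2).and h3).and h4).and self_mem_nhdsWithin).exists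
    exact ⟨δ, h5, h1, h2, h3, by linarith⟩
  -- `η` bounds the mean distance to the low frequency part, relative to `√V_N`.
  set η : ℝ := ε / (25 * (|t| + 1)) with hη
  have hη0 : 0 < η := by positivity
  have htη : |t| * (5 * η) < ε / 5 := by
    rw [hη, show |t| * (5 * (ε / (25 * (|t| + 1)))) = ε / 5 * (|t| / (|t| + 1)) by
      field_simp; ring]
    refine mul_lt_of_lt_one_right (by positivity) ?_
    rw [div_lt_one (by positivity)]
    linarith
  have hdiv : Tendsto (fun N : ℕ => N / m) atTop atTop := Nat.tendsto_div_const_atTop hm0.ne'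
  have hratio : Tendsto (fun N : ℕ => Complex.exp
      ((-(t ^ 2 * (truncVar f (N / m) / truncVar f N) / 2) : ℝ) : ℂ)) atTop
      (𝓝 (Complex.exp ((-(t ^ 2 / 2) : ℝ) : ℂ))) := by
    have h1 : Continuous fun v : ℝ => Complex.exp ((-(t ^ 2 * v / 2) : ℝ) : ℂ) := by fun_prop
    have h2 := (h1.tendsto 1).comp (hslow.tendsto_div hm0)
    simpa [Function.comp_def] using h2
  have hmax := eventually_sq_mul_le hw (hVw ▸ hslow) (hVw ▸ htop)
    (show 0 < δ ^ 2 / 2 by positivity)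
  have htail := eventually_sum_min_sq_le hw (hVw ▸ hslow) hm0 (show 0 < η ^ 2 by positivity)
  rw [← hVw] at hmax htail
  have hrat := (Metric.tendsto_nhds.mp hratio) (ε / 5) (by positivity)
  have hev := ((hslow.1.and (hdiv.eventually hmax)).and htail).and hrat
  obtain ⟨N₀, hN₀⟩ := eventually_atTop.mp hev
  refine ⟨N₀, fun N hN => ?_⟩
  obtain ⟨⟨⟨hV, hmaxN⟩, htailN⟩, hratN⟩ := hN₀ N hN.le
  set K : ℕ := N / m with hK
  have hKN : K ≤ N := Nat.div_le_self _ _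
  have hVK : truncVar f K ≤ truncVar f N := by
    rw [hVw]
    exact monotone_weightedVar hw hKN
  have hv := sum_lowCoeff_sq heven hV K
  have hv1 : ∑ i, lowCoeff f N K i ^ 2 ≤ 1 := by
    rw [hv]
    exact (div_le_one hV).mpr hVK
  have hv0 : 0 ≤ ∑ i, lowCoeff f N K i ^ 2 := Finset.sum_nonneg fun i _ => sq_nonneg _
  have hβ (i : Fin K) : |lowCoeff f N K i| ≤ δ := by
    refine abs_le_of_sq_le_sq ?_ hδ0.le
    rw [lowCoeff_sq hV, div_le_iff₀ hV]
    have h1 := hmaxN ((i : ℕ) + 1) (Finset.mem_Ioc.mpr ⟨Nat.succ_pos _, i.isLt⟩)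
    have h2 := mul_le_mul_of_nonneg_left hVK (sq_nonneg δ)
    linarith
  have hsmall : |t| ^ 3 * δ * ∑ i, lowCoeff f N K i ^ 2 ≤ |t| ^ 3 * δ :=
    mul_le_of_le_one_right (by positivity) hv1
  have h1 := norm_charFun_normalizedStat_sub_le hf heven hKN hV hη0 htailN t
  have h2 := norm_charFun_traceSq_sub_le (Nat.mul_div_le N m) hm (lowCoeff f N K) (t := t) hs0 hβ
    hδs hδt (hsmall.trans hδ3)
  have h3 : 4 * Real.exp (s ^ 2 * ∑ i, lowCoeff f N K i ^ 2) * (|t| / s) ^ m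
      ≤ 4 * Real.exp (s ^ 2) * (|t| / s) ^ m := by
    gcongr
    exact mul_le_of_le_one_right (sq_nonneg s) hv1
  rw [dist_eq_norm, ← hv] at hratN
  rw [dist_eq_norm]
  have h4 := norm_sub_le_norm_sub_add_norm_sub
    (∫ θ, Complex.exp (t * Complex.I * (normalizedStat f N θ : ℂ)) ∂(cueMeasure N))
    (∫ θ, Complex.exp (t * Complex.I *
          (centredSum (lowCoeff f N K) (traceSq K θ) : ℂ)) ∂(cueMeasure N))
    (Complex.exp ((-(t ^ 2 / 2) : ℝ) : ℂ))
  have h5 := norm_sub_le_norm_sub_add_norm_sub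
    (∫ θ, Complex.exp (t * Complex.I *
          (centredSum (lowCoeff f N K) (traceSq K θ) : ℂ)) ∂(cueMeasure N))
    (Complex.exp ((-(t ^ 2 * (∑ i, lowCoeff f N K i ^ 2) / 2) : ℝ) : ℂ))
    (Complex.exp ((-(t ^ 2 / 2) : ℝ) : ℂ))
  linarith

end PairCUE

end

theorem theorem1p2 (f : PairCUE.Torus → ℝ) (hf : MemLp f 2 volume)
    (heven : ∀ᵐ x : PairCUE.Torus, f (-x) = f x)
    (hslow : PairCUE.SlowlyVarying (PairCUE.truncVar f))
    (htop : Tendsto (PairCUE.truncVar f) atTop atTop) :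
    (∀ N : ℕ, Integrable (PairCUE.pairStat f N) (PairCUE.cueMeasure N)) ∧
      TendstoInDistribution
        (fun (N : ℕ) (θ : Fin N → PairCUE.Torus) =>
          (PairCUE.pairStat f N θ - ∫ η, PairCUE.pairStat f N η ∂(PairCUE.cueMeasure N)) /
            √(2 * PairCUE.truncVar f N))
        atTop (id : ℝ → ℝ) PairCUE.cueMeasure (gaussianReal 0 1) := by
  have hmeas (N : ℕ) : AEMeasurable (PairCUE.normalizedStat f N) (PairCUE.cueMeasure N) :=
    (PairCUE.integrable_normalizedStat hf N).aestronglyMeasurable.aemeasurable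
  refine ⟨fun N => PairCUE.integrable_pairStat (hf.integrable one_le_two) N, hmeas,
    aemeasurable_id, ?_⟩
  refine ProbabilityMeasure.tendsto_iff_tendsto_charFun.2 fun t => ?_
  have h := PairCUE.tendsto_charFun_normalizedStat hf heven hslow htop t
  have h1 (N : ℕ) : charFun ((PairCUE.cueMeasure N).map (PairCUE.normalizedStat f N)) t
      = ∫ θ, Complex.exp (t * Complex.I * (PairCUE.normalizedStat f N θ : ℂ))
          ∂(PairCUE.cueMeasure N) := by
    rw [charFun_apply_real, integral_map (hmeas N)
      (Continuous.aestronglyMeasurable (by fun_prop))]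
    refine integral_congr_ae (ae_of_all _ fun θ => ?_)
    simp only
    congr 1
    ring
  have h2 : charFun ((gaussianReal 0 1).map (id : ℝ → ℝ)) t
      = Complex.exp ((-(t ^ 2 / 2) : ℝ) : ℂ) := by
    rw [Measure.map_id, charFun_gaussianReal]
    congr 1
    push_cast
    ring
  change Tendsto (fun N => charFun ((PairCUE.cueMeasure N).map (PairCUE.normalizedStat f N)) t)
    atTop (𝓝 (charFun ((gaussianReal 0 1).map (id : ℝ → ℝ)) t))
  rw [h2]
  simpa only [h1] using h
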